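/- Fix $\kappa>0$, an inclination $0<\alpha<\pi/2$ and a volume $V_0>0$, and put $$\mathcal F(v)=\int_{\mathbb R}\tfrac12|v_x|^2+\tfrac{v^2}{2}\,\kappa\cos\alpha-v\,x\,\kappa\sin\alpha\,dx .$$ Let $\beta:\mathbb R\to\mathbb R$ be Lipschitz continuous and periodic. Let $u_0$ be an initial drop, i.e. $\{u_0>0\}=(a_0,b_0)$ is an open interval and $u_0=\operatorname{argmin}\{\mathcal F(v):v\in H^1_0(a_0,b_0),\ v\ge 0,\ \int v\,dx=V_0\}$, where functions in $H_0^1$ of an interval are identified with their continuous representatives, extended by zero. For a function $c(q,x)$, we say that $u(x,t)$, $x\in\mathbb R$, $t\ge0$, is a drop evolution with initial datum $u_0$ and velocity law $c$ if there are Lipschitz functions $a,b:[0,\infty)\to\mathbb R$ with $a(0)=a_0$, $b(0)=b_0$ such that, for all $t\ge 0$, $\{x:u(x,t)>0\}=(a(t),b(t))$ and $$u(\cdot,t)=\operatorname{argmin}\Big\{\mathcal F(v):v\in H^1_0(a(t),b(t)),\ v\ge0,\ \int v\,dx=V_0\Big\},$$ and, for a.e. $t\ge0$, the derivatives $a'(t)$,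 $b'(t)$ and the one-sided derivatives $u_x(a(t),t)$, $u_x(b(t),t)$ taken from inside the interval exist and satisfy $$\min\{a'(t)+c(\tfrac12|u_x(a(t),t)|^2,a(t)),\ |u_x(a(t),t)|\}=0,\qquad \min\{-b'(t)+c(\tfrac12|u_x(b(t),t)|^2,b(t)),\ |u_x(b(t),t)|\}=0 .$$ **Theorem 2.7.** For every $q\in\mathbb R$ the equation $x'(t)=q-\beta(x(t))$ has a global solution, and the effective speed $r(q)=\lim_{t\to\infty}\frac{x(t)-x(0)}{t}$ exists and is the same for all global solutions. Moreover: 1. If, for each $\varepsilon>0$, $u^\varepsilon$ is a drop evolution with initial datum $u_0$ and velocity law $c(q,x)=q-\beta(x/\varepsilon)$, then there is a drop evolution $u$ with initial datum $u_0$ and velocity law $c(q,x)=r(q)$ such that, as $\varepsilon\to0$, $u^\varepsilon\to u$ uniformly on $\mathbb R\times[0,T]$ for every $T>0$. 2. There is at most one drop evolution with initial datum $u_0$ and velocity law $c(q,x)=r(q)$. -/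

import Mathlib

open Set Filter Topology MeasureTheory

noncomputable section

/-- The Sobolev space `H₀¹(a, b)` in one dimension: the absolutely continuous representatives
with square integrable derivative that vanish at `a` and at `b`, extended by zero to `ℝ`.
For `b ≤ a` only the zero function is left. -/
structure MemH10 (a b : ℝ) (v : ℝ → ℝ) : Prop where
  absCont : AbsolutelyContinuousOnInterval v a b
  memLp_deriv : MemLp (deriv v) 2 volume
  eq_zero : ∀ x ∉ Ioo a b, v x = 0

/-- The energy `𝓕(v) = ∫ ½ |v_x|² + ½ v² κ cos α - v x κ sin α dx` of a drop profile `v`. -/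
def dropEnergy (κ α : ℝ) (v : ℝ → ℝ) : ℝ :=
  ∫ x, (deriv v x ^ 2 / 2 + v x ^ 2 / 2 * (κ * Real.cos α) - v x * x * (κ * Real.sin α))

/-- The profiles `v ∈ H₀¹(a, b)` with `v ≥ 0` and `∫ v dx = V₀`. -/
def dropProfiles (V₀ a b : ℝ) : Set (ℝ → ℝ) :=
  {v | MemH10 a b v ∧ (∀ x, 0 ≤ v x) ∧ ∫ x, v x = V₀}

/-- `v` is the energy minimizer among the profiles on `(a, b)` with volume `V₀`. -/
def IsDropMinimizer (κ α V₀ a b : ℝ) (v : ℝ → ℝ) : Prop :=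
  v ∈ dropProfiles V₀ a b ∧ IsMinOn (dropEnergy κ α) (dropProfiles V₀ a b) v

/-- Admissible initial data: `{u₀ > 0}` is an interval `(a₀, b₀)` and `u₀` is the energy minimizer
on it. -/
def IsInitialDrop (κ α V₀ : ℝ) (u₀ : ℝ → ℝ) : Prop :=
  ∃ a₀ b₀ : ℝ, {x | 0 < u₀ x} = Ioo a₀ b₀ ∧ IsDropMinimizer κ α V₀ a₀ b₀ u₀

/-- `u = u(x, t)`, `t ≥ 0`, is a quasi-static drop evolution with initial datum `u₀`, when the
free velocity of a contact point at position `x` with squared half slope `q = ½ |u_x|²` is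
`c q x`. The slopes `u_x(a(t))` and `u_x(b(t))` are the derivatives from inside the drop; the law
asserts that they and `a'(t)`, `b'(t)` exist, for almost every `t ≥ 0`. The condition at `t = 0`
says that `(a(0), b(0))` is the support `(a₀, b₀)` of the initial drop. -/
def IsDropSolution (κ α V₀ : ℝ) (c : ℝ → ℝ → ℝ) (u₀ : ℝ → ℝ) (u : ℝ → ℝ → ℝ) : Prop :=
  ∃ a b : ℝ → ℝ,
    (∃ K, LipschitzOnWith K a (Ici 0)) ∧ (∃ K, LipschitzOnWith K b (Ici 0)) ∧
    {x | 0 < u₀ x} = Ioo (a 0) (b 0) ∧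
    (∀ t, 0 ≤ t → {x | 0 < u x t} = Ioo (a t) (b t)) ∧
    (∀ t, 0 ≤ t → IsDropMinimizer κ α V₀ (a t) (b t) (fun x => u x t)) ∧
    (∀ᵐ t ∂(volume.restrict (Ici (0 : ℝ))), ∃ a' p : ℝ,
      HasDerivAt a a' t ∧ HasDerivWithinAt (fun x => u x t) p (Ici (a t)) (a t) ∧
      min (a' + c (p ^ 2 / 2) (a t)) |p| = 0) ∧
    (∀ᵐ t ∂(volume.restrict (Ici (0 : ℝ))), ∃ b' p : ℝ,
      HasDerivAt b b' t ∧ HasDerivWithinAt (fun x => u x t) p (Iic (b t)) (b t) ∧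
      min (-b' + c (p ^ 2 / 2) (b t)) |p| = 0)

/-- `x` is a global solution of `x'(t) = q - β(x(t))`. -/
def IsGlobalTrajectory (β : ℝ → ℝ) (q : ℝ) (x : ℝ → ℝ) : Prop :=
  ∀ t, HasDerivAt x (q - β (x t)) t

/-- `s` is the effective speed `lim_{t → ∞} (x(t) - x(0)) / t` of the equation
`x'(t) = q - β(x(t))`: global solutions exist and all of them have this speed. -/
def IsEffectiveSpeed (β : ℝ → ℝ) (q s : ℝ) : Prop :=
  (∃ x, IsGlobalTrajectory β q x) ∧
    ∀ x, IsGlobalTrajectory β q x → Tendsto (fun t => (x t - x 0) / t) atTop (𝓝 s)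

end

/-! Put `m ^ 2 = κ cos α` and `τ = tan α`. The energy is a strictly convex quadratic, and at fixed
volume a translation changes it only by a constant. So the minimizing profile is explicit and its
end slopes depend only on the width `ℓ = b - a`. The left slope decreases in `ℓ` and vanishes at a
width `w`. On a longer interval the minimizer is the profile of width `w` pushed against `b`, which
is not positive on all of `(a, b)`, so evolutions satisfy `ℓ ≤ w`. A drop evolution is therefore the
same as a system for two points: `b' = c (QB ℓ) b` and `a' ≥ -c (QA ℓ) a`, with equality when `ℓ <
w` (`IsDropSolution.exists_contactEvolution`, `IsContactEvolution.isDropSolution`).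

For the equation `x' = q - β x`, preservation of order and periodicity make displacements additive
up to one period, and Fekete's lemma yields a speed `r q` with an error bounded in time
(`exists_speed`). The function `r` is monotone and continuous, but need not be Lipschitz.

Uniqueness for the effective law rests on monotonicity instead: `r` increases and both squared
slopes decrease in `ℓ`, so of two evolutions the wider one cannot gain on the narrower
(`IsContactEvolution.width_le_width`).

For homogenization, `QB` blows up as `ℓ → 0`, which bounds the widths below and the velocities
above, uniformly in `ε`. Over a short time the slopes are nearly constant, so each contact point can
be compared with rescaled trajectories for slightly shifted `q`. These have speed `r` up to `O(ε)`,
and continuity of `r` identifies every limit point (`IsContactEvolution.of_tendsto`). By uniqueness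
all limit points coincide, so the whole family converges, and the profiles follow by uniform
continuity in the endpoints. -/

noncomputable section

/-! ### Differential inequalities holding almost everywhere -/

theorem sub_le_of_ae_deriv_le {f : ℝ → ℝ} {s e M : ℝ} (hse : s ≤ e)
    (hf : AbsolutelyContinuousOnInterval f s e)
    (h : ∀ᵐ t, t ∈ Ioc s e → ∃ d, HasDerivAt f d t ∧ d ≤ M) : f e - f s ≤ M * (e - s) := by
  rw [← hf.integral_deriv_eq_sub]
  have h1 : ∫ _ in s..e, M = M * (e - s) := by
    rw [intervalIntegral.integral_const, smul_eq_mul, mul_comm]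
  rw [← h1]
  simp only [intervalIntegral.integral_of_le hse]
  refine integral_mono_ae ?_ ?_ ?_
  · exact (intervalIntegrable_iff_integrableOn_Ioc_of_le hse).1 hf.intervalIntegrable_deriv
  · exact (intervalIntegrable_iff_integrableOn_Ioc_of_le hse).1 intervalIntegrable_const
  · rw [EventuallyLE, ae_restrict_iff' measurableSet_Ioc]
    filter_upwards [h] with t ht hts
    obtain ⟨d, hd, hdM⟩ := ht hts
    rwa [hd.deriv]

/-- After the last time `t₀` at which `w ≤ 0`, the product `exp (-K t) w t` is nonincreasing. The
inequality is needed only where `w > 0`, which is what allows laws that hold as equalities only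
below the maximal width. -/
theorem nonpos_of_ae_deriv_le_mul {w : ℝ → ℝ} {s e K : ℝ} (hse : s ≤ e)
    (hw : AbsolutelyContinuousOnInterval w s e) (hs : w s ≤ 0)
    (h : ∀ᵐ t, t ∈ Ioc s e → 0 < w t → ∃ d, HasDerivAt w d t ∧ d ≤ K * w t) : w e ≤ 0 := by
  by_contra! hpos
  have hc : ContinuousOn w (Icc s e) := by simpa [uIcc_of_le hse] using hw.continuousOn
  have hcl : IsClosed {t ∈ Icc s e | w t ≤ 0} := by
    have := hc.preimage_isClosed_of_isClosed isClosed_Icc (isClosed_Iic (a := (0 : ℝ)))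
    exact this
  have hcomp : IsCompact {t ∈ Icc s e | w t ≤ 0} :=
    isCompact_Icc.of_isClosed_subset hcl (fun t ht => ht.1)
  obtain ⟨t₀, ⟨⟨h0s, h0e⟩, h0w⟩, hmax⟩ := hcomp.exists_isGreatest ⟨s, ⟨le_rfl, hse⟩, hs⟩
  have hgt : ∀ t ∈ Ioc t₀ e, 0 < w t := by
    intro t ht
    by_contra! hle
    exact absurd (hmax ⟨⟨h0s.trans ht.1.le, ht.2⟩, hle⟩) (not_le.2 ht.1)
  have hexp : AbsolutelyContinuousOnInterval (fun t => Real.exp (-K * t)) t₀ e :=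
    ContDiffOn.absolutelyContinuousOnInterval (by fun_prop)
  have hmono : AbsolutelyContinuousOnInterval w t₀ e :=
    hw.mono (by rw [uIcc_of_le hse, uIcc_of_le h0e]; exact Icc_subset_Icc h0s le_rfl)
  have key := sub_le_of_ae_deriv_le (M := 0) h0e (hexp.fun_mul hmono) (by
    filter_upwards [h] with t ht hts
    obtain ⟨d, hd, hdK⟩ := ht ⟨h0s.trans_lt hts.1, hts.2⟩ (hgt t hts)
    have h1 : HasDerivAt (fun t => Real.exp (-K * t)) (Real.exp (-K * t) * (-K * 1)) t :=
      ((hasDerivAt_id t).const_mul (-K)).exp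
    refine ⟨_, h1.mul hd, ?_⟩
    have := Real.exp_pos (-K * t)
    nlinarith)
  have p1 := Real.exp_pos (-K * e)
  have p2 := Real.exp_pos (-K * t₀)
  have : 0 < Real.exp (-K * e) * w e := mul_pos p1 hpos
  have : Real.exp (-K * t₀) * w t₀ ≤ 0 := mul_nonpos_of_nonneg_of_nonpos p2.le h0w
  simp only [zero_mul] at key
  linarith

theorem le_of_ae_subsolution_supersolution {g : ℝ → ℝ} {K : NNReal} (hg : LipschitzWith K g)
    {y z : ℝ → ℝ} {s e : ℝ} (hse : s ≤ e) (hy : AbsolutelyContinuousOnInterval y s e)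
    (hz : AbsolutelyContinuousOnInterval z s e) (h0 : y s ≤ z s)
    (hy' : ∀ᵐ t, t ∈ Ioc s e → ∃ d, HasDerivAt y d t ∧ d ≤ g (y t))
    (hz' : ∀ᵐ t, t ∈ Ioc s e → ∃ d, HasDerivAt z d t ∧ g (z t) ≤ d) : y e ≤ z e := by
  have := nonpos_of_ae_deriv_le_mul (w := fun t => y t - z t) (K := K) hse (hy.fun_sub hz)
    (by linarith) (by
      filter_upwards [hy', hz'] with t h1 h2 ht hpos
      obtain ⟨d, hd, hdy⟩ := h1 ht
      obtain ⟨d', hd', hdz⟩ := h2 ht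
      refine ⟨_, hd.sub hd', ?_⟩
      have h3 := hg.dist_le_mul (y t) (z t)
      rw [Real.dist_eq, Real.dist_eq, abs_of_pos hpos] at h3
      have := le_abs_self (g (y t) - g (z t))
      linarith)
  linarith

theorem HasDerivAt.absolutelyContinuousOnInterval_of_bound {f f' : ℝ → ℝ} {C : ℝ}
    (hf : ∀ t, HasDerivAt f (f' t) t) (hC : ∀ t, |f' t| ≤ C) (s e : ℝ) :
    AbsolutelyContinuousOnInterval f s e := by
  have hC0 : 0 ≤ C := (abs_nonneg _).trans (hC 0)
  lift C to NNReal using hC0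
  have : LipschitzWith C f := lipschitzWith_of_nnnorm_deriv_le
    (fun t => (hf t).differentiableAt) (fun t => by
      rw [(hf t).deriv, ← NNReal.coe_le_coe]; simpa using hC t)
  exact (this.lipschitzOnWith (s := uIcc s e)).absolutelyContinuousOnInterval

/-! ### Autonomous equations with bounded Lipschitz right-hand side -/

theorem exists_solution_of_lipschitz_of_bound {g : ℝ → ℝ} {K : NNReal} (hg : LipschitzWith K g)
    {C : ℝ} (hC : ∀ x, |g x| ≤ C) (x₀ : ℝ) :
    ∃ x : ℝ → ℝ, x 0 = x₀ ∧ ∀ t, HasDerivAt x (g (x t)) t := by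
  have hC0 : 0 ≤ C := (abs_nonneg _).trans (hC 0)
  lift C to NNReal using hC0
  have hloc : ∀ n : ℕ, ∃ x : ℝ → ℝ, x 0 = x₀ ∧
      ∀ t ∈ Ioo (-(n + 1 : ℝ)) (n + 1), HasDerivAt x (g (x t)) t := by
    intro n
    -- Since `g` is bounded by `C`, a ball of radius `C * (n + 1)` contains the motion up to time `n
    -- + 1`, so Picard–Lindelöf does not shrink the time interval.
    have hn : (0 : ℝ) ≤ n := Nat.cast_nonneg n
    have hPL : IsPicardLindelof (fun _ => g) (tmin := -(n + 1 : ℝ)) (tmax := n + 1)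
        ⟨0, by constructor <;> linarith⟩ x₀ (C * (n + 1)) 0 C K := by
      refine ⟨fun t _ => hg.lipschitzOnWith, fun x _ => continuousOn_const,
        fun t _ x _ => by simpa using hC x, ?_⟩
      simp
    obtain ⟨x, hx0, hx⟩ := hPL.exists_eq_forall_mem_Icc_hasDerivWithinAt₀
    exact ⟨x, hx0, fun t ht => (hx t (Ioo_subset_Icc_self ht)).hasDerivAt (Icc_mem_nhds ht.1 ht.2)⟩
  choose x hx0 hx using hloc
  have hagree : ∀ m n : ℕ, m ≤ n → EqOn (x m) (x n) (Ioo (-(m + 1 : ℝ)) (m + 1)) := by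
    intro m n hmn
    have hm : (0 : ℝ) ≤ m := Nat.cast_nonneg m
    have hmn' : (m : ℝ) ≤ n := Nat.cast_le.2 hmn
    refine ODE_solution_unique_of_mem_Ioo (v := fun _ => g) (s := fun _ => univ) (t₀ := 0) (K := K)
      (fun t _ => hg.lipschitzOnWith) ⟨by linarith, by linarith⟩
      (fun t ht => ⟨hx m t ht, trivial⟩)
      (fun t ht => ⟨hx n t ⟨by linarith [ht.1], by linarith [ht.2]⟩, trivial⟩) (by rw [hx0, hx0])
  refine ⟨fun t => x ⌈|t|⌉₊ t, by simp [hx0], fun t => ?_⟩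
  set N := ⌈|t|⌉₊ with hN
  have htN : |t| ≤ N := Nat.le_ceil _
  have hmem : t ∈ Ioo (-(N + 1 : ℝ)) (N + 1) := by
    rw [abs_le] at htN; constructor <;> linarith
  have hev : (fun t => x ⌈|t|⌉₊ t) =ᶠ[𝓝 t] x N := by
    have hnb : Ioo (-(N + 1 : ℝ)) (N + 1) ∈ 𝓝 t := Ioo_mem_nhds hmem.1 hmem.2
    filter_upwards [hnb] with s hs
    rcases le_total ⌈|s|⌉₊ N with h | h
    · refine hagree _ _ h ?_
      have := Nat.le_ceil |s|
      rw [abs_le] at this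
      constructor <;> linarith
    · exact (hagree _ _ h hs).symm
  exact (hx N t hmem).congr_of_eventuallyEq hev

/-! ### Displacements of trajectories in a periodic field. -/

section Trajectories

variable {β : ℝ → ℝ} {K : NNReal} {L B : ℝ}

theorem IsGlobalTrajectory.abs_sub_le {q : ℝ} {x : ℝ → ℝ} (hB : ∀ x, |β x| ≤ B)
    (hx : IsGlobalTrajectory β q x) (s t : ℝ) : |x t - x s| ≤ (|q| + B) * |t - s| := by
  have := Convex.norm_image_sub_le_of_norm_hasDerivWithin_le (f := x)
    (f' := fun t => q - β (x t)) (C := |q| + B) (s := univ) (x := s) (y := t)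
    (fun t _ => (hx t).hasDerivWithinAt)
    (fun _ _ => (norm_sub_le _ _).trans (add_le_add le_rfl (hB _))) convex_univ trivial trivial
  simpa using this

theorem IsGlobalTrajectory.absolutelyContinuousOnInterval {q : ℝ} {x : ℝ → ℝ}
    (hB : ∀ x, |β x| ≤ B) (hx : IsGlobalTrajectory β q x) (s e : ℝ) :
    AbsolutelyContinuousOnInterval x s e :=
  HasDerivAt.absolutelyContinuousOnInterval_of_bound (C := |q| + B) hx
    (fun _ => (abs_sub _ _).trans (add_le_add le_rfl (hB _))) s e

theorem exists_isGlobalTrajectory (hβ : LipschitzWith K β) (hB : ∀ x, |β x| ≤ B) (q x₀ : ℝ) :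
    ∃ x, x 0 = x₀ ∧ IsGlobalTrajectory β q x := by
  have hg : LipschitzWith K (fun x => q - β x) := by
    have := (LipschitzWith.const (α := ℝ) q).sub hβ
    simpa using this
  exact exists_solution_of_lipschitz_of_bound hg (C := |q| + B)
    (fun x => (abs_sub _ _).trans (add_le_add le_rfl (hB _))) x₀

theorem IsGlobalTrajectory.shift {q : ℝ} {x : ℝ → ℝ} (hx : IsGlobalTrajectory β q x) (s : ℝ) :
    IsGlobalTrajectory β q (fun t => x (t + s)) :=
  fun t => (hx (t + s)).comp_add_const t s

theorem IsGlobalTrajectory.add_int_mul {q : ℝ} {x : ℝ → ℝ} (hper : Function.Periodic β L)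
    (hx : IsGlobalTrajectory β q x) (k : ℤ) : IsGlobalTrajectory β q (fun t => x t + k * L) := by
  intro t
  have h : β (x t + k * L) = β (x t) := hper.int_mul k (x t)
  simpa [h] using (hx t).add_const ((k : ℝ) * L)

theorem IsGlobalTrajectory.le_of_le {q q' : ℝ} {x y : ℝ → ℝ} (hβ : LipschitzWith K β)
    (hB : ∀ x, |β x| ≤ B) (hq : q ≤ q') (hy : IsGlobalTrajectory β q y)
    (hx : IsGlobalTrajectory β q' x) (h0 : y 0 ≤ x 0) {t : ℝ} (ht : 0 ≤ t) : y t ≤ x t := by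
  have hg : LipschitzWith K (fun x => q - β x) := by
    have := (LipschitzWith.const (α := ℝ) q).sub hβ
    simpa using this
  exact le_of_ae_subsolution_supersolution hg ht (hy.absolutelyContinuousOnInterval hB 0 t)
    (hx.absolutelyContinuousOnInterval hB 0 t) h0
    (ae_of_all _ fun t _ => ⟨_, hy t, le_rfl⟩)
    (ae_of_all _ fun t _ => ⟨_, hx t, by linarith⟩)

/-- Two consecutive translates of `y` by multiples of `L` enclose `x` at time `0`. They are again
trajectories, so they enclose `x` at all later times. -/
theorem IsGlobalTrajectory.abs_displacement_sub_le {q : ℝ} {x y : ℝ → ℝ} (hβ : LipschitzWith K β)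
    (hB : ∀ x, |β x| ≤ B) (hL : 0 < L) (hper : Function.Periodic β L)
    (hx : IsGlobalTrajectory β q x) (hy : IsGlobalTrajectory β q y) {t : ℝ} (ht : 0 ≤ t) :
    |(x t - x 0) - (y t - y 0)| ≤ L := by
  set k := ⌊(x 0 - y 0) / L⌋ with hk
  have h1 : (k : ℝ) * L ≤ x 0 - y 0 := by
    rw [← le_div_iff₀ hL]; exact Int.floor_le _
  have h2 : x 0 - y 0 ≤ (k + 1) * L := by
    rw [← div_le_iff₀ hL]; exact (Int.lt_floor_add_one _).le
  have h3 := (hy.add_int_mul hper k).le_of_le hβ hB le_rfl hx (by linarith) ht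
  have h4 := hx.le_of_le hβ hB le_rfl (hy.add_int_mul hper (k + 1)) (by push_cast; linarith) ht
  push_cast at h3 h4
  rw [abs_le]
  constructor <;> linarith

/-- Displacements of trajectories grow linearly, up to a bounded error. -/
theorem exists_speed (hβ : LipschitzWith K β) (hB : ∀ x, |β x| ≤ B) (hL : 0 < L)
    (hper : Function.Periodic β L) (q : ℝ) :
    ∃ r : ℝ, ∀ x, IsGlobalTrajectory β q x → ∀ t, 0 ≤ t →
      |x t - x 0 - r * t| ≤ 4 * L + 2 * (|q| + B) := by
  obtain ⟨x, hx0, hx⟩ := exists_isGlobalTrajectory hβ hB q 0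
  set C := |q| + B with hC
  have hB0 : 0 ≤ B := (abs_nonneg _).trans (hB 0)
  have hC0 : 0 ≤ C := by positivity
  -- The trajectory restarted at time `s` and the original one have displacements over time `t` that
  -- differ by at most `L`.
  have hquasi : ∀ s t, 0 ≤ t → |x (t + s) - x t - x s| ≤ L := by
    intro s t ht
    have h := (hx.shift s).abs_displacement_sub_le hβ hB hL hper hx ht
    simp only [hx0, zero_add] at h
    rw [abs_le] at h ⊢
    constructor <;> linarith [h.1, h.2]
  have hlin : ∀ t, 0 ≤ t → |x t| ≤ C * t := by
    intro t ht
    have := hx.abs_sub_le hB 0 t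
    rwa [hx0, sub_zero, sub_zero, abs_of_nonneg ht] at this
  -- Fekete's lemma is used for both `x n + L` and `-x n + L`. The limits are opposite, and as each
  -- limit is also an infimum, the deviation of `x n` from `r * n` is at most `L`.
  have hu : Subadditive (fun n : ℕ => x n + L) := by
    intro m n
    have := (abs_le.1 (hquasi n m m.cast_nonneg)).2
    push_cast
    linarith
  have hv : Subadditive (fun n : ℕ => -x n + L) := by
    intro m n
    have := (abs_le.1 (hquasi n m m.cast_nonneg)).1
    push_cast
    linarith
  have hdiv : ∀ (n : ℕ) (z : ℝ), |z| ≤ C * n → -C ≤ (z + L) / n := by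
    intro n z hz
    rcases Nat.eq_zero_or_pos n with rfl | hn
    · simpa using hC0
    · have hn' : (0 : ℝ) < n := Nat.cast_pos.2 hn
      rw [le_div_iff₀ hn']
      linarith [(abs_le.1 hz).1]
  have hub : BddBelow (range fun n : ℕ => (x n + L) / n) := by
    refine ⟨-C, ?_⟩
    rintro _ ⟨n, rfl⟩
    exact hdiv n _ (hlin n n.cast_nonneg)
  have hvb : BddBelow (range fun n : ℕ => (-x n + L) / n) := by
    refine ⟨-C, ?_⟩
    rintro _ ⟨n, rfl⟩
    exact hdiv n _ (by rw [abs_neg]; exact hlin n n.cast_nonneg)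
  have hsum : hu.lim + hv.lim = 0 := by
    have h1 := (hu.tendsto_lim hub).add (hv.tendsto_lim hvb)
    have h2 : Tendsto (fun n : ℕ => 2 * L / (n : ℝ)) atTop (𝓝 0) :=
      tendsto_const_div_atTop_nhds_zero_nat _
    refine tendsto_nhds_unique h1 (h2.congr fun n => ?_)
    rw [← add_div]; ring
  set r := hu.lim with hr
  have hint : ∀ n : ℕ, |x n - r * n| ≤ L := by
    intro n
    rcases Nat.eq_zero_or_pos n with rfl | hn
    · simp [hx0, hL.le]
    · have hn' : (0 : ℝ) < n := Nat.cast_pos.2 hn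
      have h1 := hu.lim_le_div hub hn.ne'
      have h2 := hv.lim_le_div hvb hn.ne'
      rw [le_div_iff₀ hn'] at h1 h2
      have h3 : hv.lim = -r := by linarith
      rw [h3] at h2
      rw [abs_le]
      constructor <;> linarith
  have hrC : |r| ≤ C + L := by
    have h1 := hint 1
    have h2 := hlin 1 zero_le_one
    simp only [Nat.cast_one, mul_one] at h1 h2
    rw [abs_le] at *
    constructor <;> linarith
  -- The error collects `L` from replacing `y` by `x`, `L` from splitting `t` at its integer part,
  -- `L` at the integer, and `C` and `C + L` from the remaining fraction of time.
  refine ⟨r, fun y hy t ht => ?_⟩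
  have h0 := hy.abs_displacement_sub_le hβ hB hL hper hx ht
  set n := ⌊t⌋₊ with hn
  have hn1 : (n : ℝ) ≤ t := Nat.floor_le ht
  have hn2 : t < n + 1 := Nat.lt_floor_add_one t
  have h1 := hint n
  have h2 := hquasi (t - n) n n.cast_nonneg
  have h3 := hlin (t - n) (by linarith)
  have h4 : |r * (t - n)| ≤ C + L := by
    rw [abs_mul, abs_of_nonneg (by linarith : 0 ≤ t - n)]
    nlinarith [abs_nonneg r]
  have h5 : C * (t - n) ≤ C := by nlinarith
  rw [show (n : ℝ) + (t - n) = t by ring] at h2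
  rw [hx0] at h0
  rw [abs_le] at *
  constructor <;> nlinarith

end Trajectories

/-- `r` is the speed of the trajectories of `x' = q - β x`, with errors controlled by `C q`. -/
structure HasSpeed (β : ℝ → ℝ) (r C : ℝ → ℝ) : Prop where
  abs_sub_le : ∀ q x, IsGlobalTrajectory β q x → ∀ t, 0 ≤ t → |x t - x 0 - r q * t| ≤ C q

theorem tendsto_div_of_abs_sub_mul_le {f : ℝ → ℝ} {r C : ℝ}
    (h : ∀ t, 0 ≤ t → |f t - r * t| ≤ C) : Tendsto (fun t => f t / t) atTop (𝓝 r) := by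
  rw [tendsto_iff_dist_tendsto_zero]
  refine squeeze_zero' (g := fun t => C / t) (Eventually.of_forall fun _ => dist_nonneg) ?_
    (tendsto_const_nhds.div_atTop tendsto_id)
  filter_upwards [eventually_gt_atTop 0] with t ht
  rw [Real.dist_eq, le_div_iff₀ ht, ← abs_of_pos ht, ← abs_mul, abs_of_pos ht]
  have : (f t / t - r) * t = f t - r * t := by field_simp
  rw [this]
  exact h t ht.le

/-! ### Monotonicity and continuity of the effective speed. -/

section Speed

variable {β : ℝ → ℝ} {K : NNReal} {L B : ℝ} {r C : ℝ → ℝ}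

theorem HasSpeed.isEffectiveSpeed (h : HasSpeed β r C) (hβ : LipschitzWith K β)
    (hB : ∀ x, |β x| ≤ B) (q : ℝ) : IsEffectiveSpeed β q (r q) := by
  obtain ⟨x, -, hx⟩ := exists_isGlobalTrajectory hβ hB q 0
  exact ⟨⟨x, hx⟩, fun y hy => tendsto_div_of_abs_sub_mul_le (h.abs_sub_le q y hy)⟩

theorem HasSpeed.monotone (h : HasSpeed β r C) (hβ : LipschitzWith K β)
    (hB : ∀ x, |β x| ≤ B) : Monotone r := by
  intro q q' hqq
  obtain ⟨x, hx0, hx⟩ := exists_isGlobalTrajectory hβ hB q 0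
  obtain ⟨y, hy0, hy⟩ := exists_isGlobalTrajectory hβ hB q' 0
  have h1 := tendsto_div_of_abs_sub_mul_le (h.abs_sub_le q x hx)
  have h2 := tendsto_div_of_abs_sub_mul_le (h.abs_sub_le q' y hy)
  refine le_of_tendsto_of_tendsto h1 h2 ?_
  filter_upwards [eventually_gt_atTop 0] with t ht
  have := hx.le_of_le hβ hB hqq hy (by rw [hx0, hy0]) ht.le
  rw [hx0, hy0]
  gcongr

theorem exists_hasSpeed (hβ : LipschitzWith K β) (hB : ∀ x, |β x| ≤ B) (hL : 0 < L)
    (hper : Function.Periodic β L) :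
    ∃ r, HasSpeed β r fun q => 4 * L + 2 * (|q| + B) := by
  choose r hr using exists_speed hβ hB hL hper
  exact ⟨r, ⟨hr⟩⟩

/-- At a fixed time the position is continuous in `q` by Grönwall, and `displacement / T`
approximates `r` with error `C q / T`, locally uniformly in `q`. -/
theorem HasSpeed.continuous (h : HasSpeed β r C) (hC : Continuous C) (hβ : LipschitzWith K β)
    (hB : ∀ x, |β x| ≤ B) : Continuous r := by
  choose x hx0 hx using fun q => exists_isGlobalTrajectory hβ hB q 0
  have hcont : ∀ t, 0 ≤ t → Continuous fun q => x q t := by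
    intro t ht
    rw [continuous_iff_continuousAt]
    intro q₀
    have hb : ∀ q, dist (x q t) (x q₀ t) ≤ gronwallBound 0 K (|q - q₀| + 0) (t - 0) := by
      intro q
      refine dist_le_of_approx_trajectories_ODE (v := fun _ x => q₀ - β x) (a := 0) (b := t)
        (f := x q) (f' := fun t => q - β (x q t)) (g := x q₀) (g' := fun t => q₀ - β (x q₀ t))
        ?_ ?_ ?_ ?_ ?_ ?_ ?_ ?_ t ⟨ht, le_rfl⟩
      · intro _
        have := (LipschitzWith.const (α := ℝ) q₀).sub hβ
        simpa using this
      · exact fun t _ => (hx q t).continuousAt.continuousWithinAt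
      · exact fun t _ => (hx q t).hasDerivWithinAt
      · intro t _; simp [Real.dist_eq]
      · exact fun t _ => (hx q₀ t).continuousAt.continuousWithinAt
      · exact fun t _ => (hx q₀ t).hasDerivWithinAt
      · simp
      · simp [hx0]
    rw [ContinuousAt, tendsto_iff_dist_tendsto_zero]
    refine squeeze_zero (fun _ => dist_nonneg) hb ?_
    have h1 : Continuous fun q => gronwallBound 0 K (|q - q₀| + 0) (t - 0) :=
      (gronwallBound_continuous_ε 0 K (t - 0)).comp (by fun_prop)
    have h2 := h1.tendsto q₀
    simpa [gronwallBound_ε0_δ0] using h2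
  rw [continuous_iff_continuousAt]
  intro q₀
  have hbnd : ∀ᶠ q in 𝓝 q₀, C q ≤ C q₀ + 1 :=
    (hC.tendsto q₀).eventually (eventually_le_nhds (by linarith))
  rw [Metric.continuousAt_iff']
  intro δ hδ
  have hC0 : 0 ≤ C q₀ := (abs_nonneg _).trans (h.abs_sub_le q₀ _ (hx q₀) 0 le_rfl)
  -- Three errors, from the speeds at `q` and `q₀` and from the distance of the two positions, are
  -- each at most `C q₀ + 1`.
  set T := 3 * (C q₀ + 1) / δ with hT
  have hT0 : 0 < T := by positivity
  have hTd : T * δ = 3 * (C q₀ + 1) := by rw [hT]; field_simp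
  have hclose : ∀ᶠ q in 𝓝 q₀, dist (x q T) (x q₀ T) < 1 :=
    Metric.tendsto_nhds.1 ((hcont T hT0.le).tendsto q₀) 1 one_pos
  filter_upwards [hbnd, hclose] with q h1 h2
  have h3 := h.abs_sub_le q _ (hx q) T hT0.le
  have h4 := h.abs_sub_le q₀ _ (hx q₀) T hT0.le
  rw [hx0] at h3 h4
  rw [Real.dist_eq] at h2 ⊢
  have h5 : |r q - r q₀| * T < δ * T := by
    rw [← abs_of_pos hT0, ← abs_mul, abs_of_pos hT0, mul_comm δ, hTd]
    rw [abs_lt] at *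
    rw [abs_le] at *
    constructor <;> nlinarith
  exact lt_of_mul_lt_mul_right h5 hT0.le

/-! ### Homogenization of differential inequalities -/

theorem HasSpeed.exists_scaled_forward (h : HasSpeed β r C) (hβ : LipschitzWith K β)
    (hB : ∀ x, |β x| ≤ B) {ε : ℝ} (hε : 0 < ε) (q s X₀ : ℝ) :
    ∃ X : ℝ → ℝ, X s = X₀ ∧ (∀ t, HasDerivAt X (q - β (X t / ε)) t) ∧
      ∀ e, s ≤ e → |X e - X s - r q * (e - s)| ≤ ε * C q := by
  obtain ⟨x, hx0, hx⟩ := exists_isGlobalTrajectory hβ hB q (X₀ / ε)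
  refine ⟨fun t => ε * x ((t - s) / ε), ?_, fun t => ?_, fun e hse => ?_⟩
  · simp [hx0]; field_simp
  · have h1 : HasDerivAt (fun t => (t - s) / ε) (1 / ε) t :=
      ((hasDerivAt_id t).sub_const s).div_const ε
    have h2 := ((hx ((t - s) / ε)).comp t h1).const_mul ε
    convert! h2 using 1
    field_simp
  · have h1 := h.abs_sub_le q x hx ((e - s) / ε) (by have := sub_nonneg.2 hse; positivity)
    simp only [sub_self, zero_div]
    have h2 : ε * x ((e - s) / ε) - ε * x 0 - r q * (e - s)
        = ε * (x ((e - s) / ε) - x 0 - r q * ((e - s) / ε)) := by field_simp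
    rw [h2, abs_mul, abs_of_pos hε]
    gcongr

theorem HasSpeed.exists_scaled_backward (h : HasSpeed β r C) (hβ : LipschitzWith K β)
    (hB : ∀ x, |β x| ≤ B) {ε : ℝ} (hε : 0 < ε) (q s X₀ : ℝ) :
    ∃ X : ℝ → ℝ, X s = X₀ ∧ (∀ t, HasDerivAt X (-(q - β (X t / ε))) t) ∧
      ∀ e, s ≤ e → |X e - X s + r q * (e - s)| ≤ ε * C q := by
  obtain ⟨x, hx0, hx⟩ := exists_isGlobalTrajectory hβ hB q (X₀ / ε)
  refine ⟨fun t => ε * x (-((t - s) / ε)), ?_, fun t => ?_, fun e hse => ?_⟩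
  · simp [hx0]; field_simp
  · have h1 : HasDerivAt (fun t => -((t - s) / ε)) (-(1 / ε)) t :=
      (((hasDerivAt_id t).sub_const s).div_const ε).neg
    have h2 := ((hx (-((t - s) / ε))).comp t h1).const_mul ε
    convert! h2 using 1
    field_simp
  -- The speed estimate covers only forward time, so the reversed motion is read as a trajectory
  -- started at its final position.
  · have h1 := h.abs_sub_le q _ (hx.shift (-((e - s) / ε))) ((e - s) / ε)
      (by have := sub_nonneg.2 hse; positivity)
    simp only [sub_self, zero_div, neg_zero, zero_add, add_neg_cancel] at h1 ⊢
    have h2 : ε * x (-((e - s) / ε)) - ε * x 0 + r q * (e - s)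
        = -(ε * (x 0 - x (-((e - s) / ε)) - r q * ((e - s) / ε))) := by field_simp; ring
    rw [h2, abs_neg, abs_mul, abs_of_pos hε]
    gcongr

/-- The Lipschitz constant may depend on `ε`: it only makes the comparison principle available and
does not enter the estimates. -/
theorem lipschitzWith_sub_comp_div (hβ : LipschitzWith K β) (ε q : ℝ) :
    ∃ K', LipschitzWith K' (fun y => q - β (y / ε)) := by
  have h1 : LipschitzWith ‖ε⁻¹‖₊ (fun y : ℝ => y / ε) := by
    refine LipschitzWith.of_dist_le_mul fun x y => ?_
    rw [Real.dist_eq, Real.dist_eq, ← sub_div, div_eq_mul_inv, abs_mul, mul_comm]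
    simp
  exact ⟨_, (LipschitzWith.const (α := ℝ) q).sub (hβ.comp h1)⟩

variable {y : ℝ → ℝ} {s e ε q : ℝ}

/-- Comparison with the rescaled trajectory that starts at `y s`. The three variants below cover
lower bounds and the reversed motion, which is that of a left contact point. -/
theorem HasSpeed.sub_le_of_forward (h : HasSpeed β r C) (hβ : LipschitzWith K β)
    (hB : ∀ x, |β x| ≤ B) (hε : 0 < ε) (hse : s ≤ e)
    (hy : AbsolutelyContinuousOnInterval y s e)
    (hy' : ∀ᵐ t, t ∈ Ioc s e → ∃ d, HasDerivAt y d t ∧ d ≤ q - β (y t / ε)) :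
    y e - y s ≤ r q * (e - s) + ε * C q := by
  obtain ⟨X, hXs, hX, hXe⟩ := h.exists_scaled_forward hβ hB hε q s (y s)
  obtain ⟨K', hK'⟩ := lipschitzWith_sub_comp_div hβ ε q
  have hac := HasDerivAt.absolutelyContinuousOnInterval_of_bound (C := |q| + B) hX
    (fun t => (abs_sub _ _).trans (add_le_add le_rfl (hB _))) s e
  have := le_of_ae_subsolution_supersolution hK' hse hy hac hXs.ge hy'
    (ae_of_all _ fun t _ => ⟨_, hX t, le_rfl⟩)
  have h1 := abs_le.1 (hXe e hse)
  linarith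

theorem HasSpeed.le_sub_of_forward (h : HasSpeed β r C) (hβ : LipschitzWith K β)
    (hB : ∀ x, |β x| ≤ B) (hε : 0 < ε) (hse : s ≤ e)
    (hy : AbsolutelyContinuousOnInterval y s e)
    (hy' : ∀ᵐ t, t ∈ Ioc s e → ∃ d, HasDerivAt y d t ∧ q - β (y t / ε) ≤ d) :
    r q * (e - s) - ε * C q ≤ y e - y s := by
  obtain ⟨X, hXs, hX, hXe⟩ := h.exists_scaled_forward hβ hB hε q s (y s)
  obtain ⟨K', hK'⟩ := lipschitzWith_sub_comp_div hβ ε q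
  have hac := HasDerivAt.absolutelyContinuousOnInterval_of_bound (C := |q| + B) hX
    (fun t => (abs_sub _ _).trans (add_le_add le_rfl (hB _))) s e
  have := le_of_ae_subsolution_supersolution hK' hse hac hy hXs.le
    (ae_of_all _ fun t _ => ⟨_, hX t, le_rfl⟩) hy'
  have h1 := abs_le.1 (hXe e hse)
  linarith

theorem HasSpeed.sub_le_of_backward (h : HasSpeed β r C) (hβ : LipschitzWith K β)
    (hB : ∀ x, |β x| ≤ B) (hε : 0 < ε) (hse : s ≤ e)
    (hy : AbsolutelyContinuousOnInterval y s e)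
    (hy' : ∀ᵐ t, t ∈ Ioc s e → ∃ d, HasDerivAt y d t ∧ d ≤ -(q - β (y t / ε))) :
    y e - y s ≤ -r q * (e - s) + ε * C q := by
  obtain ⟨X, hXs, hX, hXe⟩ := h.exists_scaled_backward hβ hB hε q s (y s)
  obtain ⟨K', hK'⟩ := lipschitzWith_sub_comp_div hβ ε q
  have hac := HasDerivAt.absolutelyContinuousOnInterval_of_bound (C := |q| + B) hX
    (fun t => by rw [abs_neg]; exact (abs_sub _ _).trans (add_le_add le_rfl (hB _))) s e
  have := le_of_ae_subsolution_supersolution hK'.neg hse hy hac hXs.ge hy'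
    (ae_of_all _ fun t _ => ⟨_, hX t, le_rfl⟩)
  have h1 := abs_le.1 (hXe e hse)
  linarith

theorem HasSpeed.le_sub_of_backward (h : HasSpeed β r C) (hβ : LipschitzWith K β)
    (hB : ∀ x, |β x| ≤ B) (hε : 0 < ε) (hse : s ≤ e)
    (hy : AbsolutelyContinuousOnInterval y s e)
    (hy' : ∀ᵐ t, t ∈ Ioc s e → ∃ d, HasDerivAt y d t ∧ -(q - β (y t / ε)) ≤ d) :
    -r q * (e - s) - ε * C q ≤ y e - y s := by
  obtain ⟨X, hXs, hX, hXe⟩ := h.exists_scaled_backward hβ hB hε q s (y s)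
  obtain ⟨K', hK'⟩ := lipschitzWith_sub_comp_div hβ ε q
  have hac := HasDerivAt.absolutelyContinuousOnInterval_of_bound (C := |q| + B) hX
    (fun t => by rw [abs_neg]; exact (abs_sub _ _).trans (add_le_add le_rfl (hB _))) s e
  have := le_of_ae_subsolution_supersolution hK'.neg hse hac hy hXs.le
    (ae_of_all _ fun t _ => ⟨_, hX t, le_rfl⟩) hy'
  have h1 := abs_le.1 (hXe e hse)
  linarith

end Speed

/-! ### Evolutions of the two contact points -/

/-- `QA ℓ`, `QB ℓ` behave like the squared half slopes at the two contact points of a drop of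
width `ℓ`, which is positive on its support only for `ℓ ≤ w`. -/
structure IsSlopeLaw (QA QB : ℝ → ℝ) (w : ℝ) : Prop where
  antitoneA : AntitoneOn QA (Ioc 0 w)
  antitoneB : AntitoneOn QB (Ioc 0 w)
  continuousA : ContinuousOn QA (Ioc 0 w)
  continuousB : ContinuousOn QB (Ioc 0 w)
  nonnegA : ∀ ℓ ∈ Ioc 0 w, 0 ≤ QA ℓ
  unboundedB : ∀ C, ∃ ℓ ∈ Ioc 0 w, C ≤ QB ℓ

/-- The contact points `a < b` move with velocities `-c (QA (b - a)) a` and `c (QB (b - a)) b`,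
except that `a` may be dragged along when the width has its maximal value `w`. -/
structure IsContactEvolution (QA QB : ℝ → ℝ) (w : ℝ) (c : ℝ → ℝ → ℝ) (a b : ℝ → ℝ) : Prop where
  lipschitzA : ∃ K, LipschitzOnWith K a (Ici 0)
  lipschitzB : ∃ K, LipschitzOnWith K b (Ici 0)
  width_mem : ∀ t, 0 ≤ t → b t - a t ∈ Ioc 0 w
  lawA : ∀ᵐ t, 0 ≤ t → ∃ d, HasDerivAt a d t ∧ -c (QA (b t - a t)) (a t) ≤ d ∧
    (b t - a t < w → d = -c (QA (b t - a t)) (a t))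
  lawB : ∀ᵐ t, 0 ≤ t → HasDerivAt b (c (QB (b t - a t)) (b t)) t

theorem LipschitzOnWith.absolutelyContinuousOnInterval_of_nonneg {f : ℝ → ℝ}
    (hf : ∃ K, LipschitzOnWith K f (Ici 0)) {s e : ℝ} (hs : 0 ≤ s) (hse : s ≤ e) :
    AbsolutelyContinuousOnInterval f s e := by
  obtain ⟨K, hK⟩ := hf
  refine (hK.mono ?_).absolutelyContinuousOnInterval
  rw [uIcc_of_le hse]
  exact fun t ht => hs.trans ht.1

variable {QA QB r C β : ℝ → ℝ} {w B : ℝ}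

/-- While the first drop is wider, the second is below the width `w`, so its left law is an
equality, whereas for the first one the inequality has the right sign. Monotonicity of `r` and of
the slopes then makes the difference of widths nonincreasing. -/
theorem IsContactEvolution.width_le_width {a₁ b₁ a₂ b₂ : ℝ → ℝ} (hQ : IsSlopeLaw QA QB w)
    (hr : Monotone r) (h₁ : IsContactEvolution QA QB w (fun q _ => r q) a₁ b₁)
    (h₂ : IsContactEvolution QA QB w (fun q _ => r q) a₂ b₂)
    (h0 : b₁ 0 - a₁ 0 ≤ b₂ 0 - a₂ 0) {t : ℝ} (ht : 0 ≤ t) :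
    b₁ t - a₁ t ≤ b₂ t - a₂ t := by
  have key := nonpos_of_ae_deriv_le_mul (w := fun t => (b₁ t - a₁ t) - (b₂ t - a₂ t)) (K := 0) ht
    (((LipschitzOnWith.absolutelyContinuousOnInterval_of_nonneg h₁.lipschitzB le_rfl ht).fun_sub
      (LipschitzOnWith.absolutelyContinuousOnInterval_of_nonneg h₁.lipschitzA le_rfl ht)).fun_sub
      ((LipschitzOnWith.absolutelyContinuousOnInterval_of_nonneg h₂.lipschitzB le_rfl ht).fun_sub
      (LipschitzOnWith.absolutelyContinuousOnInterval_of_nonneg h₂.lipschitzA le_rfl ht)))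
    (by linarith) (by
      filter_upwards [h₁.lawA, h₁.lawB, h₂.lawA, h₂.lawB] with s ha₁ hb₁ ha₂ hb₂ hs hpos
      have hs0 : 0 ≤ s := hs.1.le
      obtain ⟨d₁, hd₁, hle₁, -⟩ := ha₁ hs0
      obtain ⟨d₂, hd₂, -, heq₂⟩ := ha₂ hs0
      have m₁ := h₁.width_mem s hs0
      have m₂ := h₂.width_mem s hs0
      have hlt : b₂ s - a₂ s < b₁ s - a₁ s := by linarith
      have e₂ := heq₂ (hlt.trans_le m₁.2)
      refine ⟨_, ((hb₁ hs0).sub hd₁).sub ((hb₂ hs0).sub hd₂), ?_⟩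
      have i₁ := hr (hQ.antitoneA m₂ m₁ hlt.le)
      have i₂ := hr (hQ.antitoneB m₂ m₁ hlt.le)
      linarith)
  linarith

/-- Once the widths agree, so do the velocities of the right contact points, which depend on the
width only. -/
theorem IsContactEvolution.eq {a₁ b₁ a₂ b₂ : ℝ → ℝ} (hQ : IsSlopeLaw QA QB w)
    (hr : Monotone r) (h₁ : IsContactEvolution QA QB w (fun q _ => r q) a₁ b₁)
    (h₂ : IsContactEvolution QA QB w (fun q _ => r q) a₂ b₂)
    (ha0 : a₁ 0 = a₂ 0) (hb0 : b₁ 0 = b₂ 0) {t : ℝ} (ht : 0 ≤ t) :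
    a₁ t = a₂ t ∧ b₁ t = b₂ t := by
  have hw : ∀ s, 0 ≤ s → b₁ s - a₁ s = b₂ s - a₂ s := fun s hs =>
    le_antisymm (h₁.width_le_width hQ hr h₂ (by rw [ha0, hb0]) hs)
      (h₂.width_le_width hQ hr h₁ (by rw [ha0, hb0]) hs)
  have hac₁ := LipschitzOnWith.absolutelyContinuousOnInterval_of_nonneg h₁.lipschitzB le_rfl ht
  have hac₂ := LipschitzOnWith.absolutelyContinuousOnInterval_of_nonneg h₂.lipschitzB le_rfl ht
  have k₁ := sub_le_of_ae_deriv_le (M := 0) ht (hac₁.fun_sub hac₂) (by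
    filter_upwards [h₁.lawB, h₂.lawB] with s hb₁ hb₂ hs
    exact ⟨_, (hb₁ hs.1.le).sub (hb₂ hs.1.le), by rw [hw s hs.1.le]; simp⟩)
  have k₂ := sub_le_of_ae_deriv_le (M := 0) ht (hac₂.fun_sub hac₁) (by
    filter_upwards [h₁.lawB, h₂.lawB] with s hb₁ hb₂ hs
    exact ⟨_, (hb₂ hs.1.le).sub (hb₁ hs.1.le), by rw [hw s hs.1.le]; simp⟩)
  have := hw t ht
  constructor <;> linarith

/-! ### Estimates uniform in `ε`. -/

section Bounds

variable {ε m : ℝ} {a b : ℝ → ℝ}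

/-- Below the width `m` the drop cannot shrink: `QB ≥ 2 * B` outweighs both oscillating terms, `QA`
is nonnegative, and the left law is an equality since `m ≤ w`. -/
theorem IsContactEvolution.le_width (hQ : IsSlopeLaw QA QB w) (hB : ∀ x, |β x| ≤ B)
    (h : IsContactEvolution QA QB w (fun q x => q - β (x / ε)) a b) (hm : m ∈ Ioc 0 w)
    (hmB : 2 * B ≤ QB m) (h0 : m ≤ b 0 - a 0) {t : ℝ} (ht : 0 ≤ t) : m ≤ b t - a t := by
  have key := nonpos_of_ae_deriv_le_mul (w := fun t => m - (b t - a t)) (K := 0) ht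
    (AbsolutelyContinuousOnInterval.fun_sub
      (ContDiffOn.absolutelyContinuousOnInterval (by fun_prop))
      ((LipschitzOnWith.absolutelyContinuousOnInterval_of_nonneg h.lipschitzB le_rfl ht).fun_sub
      (LipschitzOnWith.absolutelyContinuousOnInterval_of_nonneg h.lipschitzA le_rfl ht)))
    (by linarith) (by
      filter_upwards [h.lawA, h.lawB] with s ha hb hs hpos
      have hs0 : 0 ≤ s := hs.1.le
      have ms := h.width_mem s hs0
      obtain ⟨d, hd, -, heq⟩ := ha hs0
      have e := heq (by linarith [hm.2])
      refine ⟨_, ((hb hs0).sub hd).const_sub m, ?_⟩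
      have i₁ := hQ.nonnegA _ ms
      have i₂ := hQ.antitoneB ms hm (by linarith)
      have i₃ := (abs_le.1 (hB (a s / ε))).2
      have i₄ := (abs_le.1 (hB (b s / ε))).2
      linarith)
  linarith

theorem IsContactEvolution.speed_le (hQ : IsSlopeLaw QA QB w) (hB : ∀ x, |β x| ≤ B)
    (h : IsContactEvolution QA QB w (fun q x => q - β (x / ε)) a b) (hm : m ∈ Ioc 0 w)
    (hmw : ∀ t, 0 ≤ t → m ≤ b t - a t) {M : ℝ} (hMA : QA m + B ≤ M) (hMB : QB m + B ≤ M)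
    (hQB : ∀ ℓ ∈ Ioc 0 w, 0 ≤ QB ℓ) {s t : ℝ} (hs : 0 ≤ s) (hst : s ≤ t) :
    |a t - a s| ≤ M * (t - s) ∧ |b t - b s| ≤ M * (t - s) := by
  have hA := LipschitzOnWith.absolutelyContinuousOnInterval_of_nonneg h.lipschitzA hs hst
  have hBB := LipschitzOnWith.absolutelyContinuousOnInterval_of_nonneg h.lipschitzB hs hst
  have bound : ∀ᵐ τ, τ ∈ Ioc s t → (∃ d, HasDerivAt a d τ ∧ d ≤ M ∧ -M ≤ d) ∧
      ∃ d, HasDerivAt b d τ ∧ d ≤ M ∧ -M ≤ d := by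
    filter_upwards [h.lawA, h.lawB] with τ ha hb hτ
    have hτ0 : 0 < τ := hs.trans_lt hτ.1
    obtain ⟨d, hd, hle, heq⟩ := ha hτ0.le
    have hb := hb hτ0.le
    have mτ := h.width_mem τ hτ0.le
    have iA := hQ.antitoneA hm mτ (hmw τ hτ0.le)
    have iB := hQ.antitoneB hm mτ (hmw τ hτ0.le)
    have nA := hQ.nonnegA _ mτ
    have nB := hQB _ mτ
    have i₃ := abs_le.1 (hB (a τ / ε))
    have i₄ := abs_le.1 (hB (b τ / ε))
    have nA' := hQ.nonnegA _ hm
    refine ⟨⟨d, hd, ?_, by linarith⟩, ⟨_, hb, by linarith, by linarith⟩⟩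
    rcases mτ.2.lt_or_eq with hlt | hmax
    · have := heq hlt
      linarith
    -- At the maximal width the law gives no upper bound for `a'`. There the width has a local
    -- maximum in time, hence `a' = b'`.
    · have hloc : IsLocalMax (fun τ => b τ - a τ) τ := by
        filter_upwards [Ici_mem_nhds hτ0] with σ hσ
        simpa only [hmax] using (h.width_mem σ hσ).2
      have := hloc.hasDerivAt_eq_zero (hb.sub hd)
      linarith
  refine ⟨abs_le.2 ⟨?_, ?_⟩, abs_le.2 ⟨?_, ?_⟩⟩
  · have := sub_le_of_ae_deriv_le (M := M) hst hA.fun_neg (by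
      filter_upwards [bound] with τ hτ h
      obtain ⟨⟨d, hd, h1, h2⟩, -⟩ := hτ h
      exact ⟨_, hd.neg, by linarith⟩)
    linarith
  · exact sub_le_of_ae_deriv_le hst hA (by
      filter_upwards [bound] with τ hτ h
      obtain ⟨⟨d, hd, h1, h2⟩, -⟩ := hτ h
      exact ⟨_, hd, h1⟩)
  · have := sub_le_of_ae_deriv_le (M := M) hst hBB.fun_neg (by
      filter_upwards [bound] with τ hτ h
      obtain ⟨-, ⟨d, hd, h1, h2⟩⟩ := hτ h
      exact ⟨_, hd.neg, by linarith⟩)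
    linarith
  · exact sub_le_of_ae_deriv_le hst hBB (by
      filter_upwards [bound] with τ hτ h
      obtain ⟨-, ⟨d, hd, h1, h2⟩⟩ := hτ h
      exact ⟨_, hd, h1⟩)

end Bounds

theorem HasDerivAt.le_of_sub_le_right {f : ℝ → ℝ} {d m t h : ℝ} (hf : HasDerivAt f d t)
    (hh : 0 < h) (hle : ∀ s ∈ Icc t (t + h), f s - f t ≤ m * (s - t)) : d ≤ m := by
  have h1 := (hasDerivWithinAt_iff_tendsto_slope' self_notMem_Ioi).1
    (hf.hasDerivWithinAt (s := Ioi t))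
  refine le_of_tendsto h1 ?_
  filter_upwards [Ioc_mem_nhdsGT (show t < t + h by linarith)] with s hs
  rw [slope_def_field, div_le_iff₀ (by linarith [hs.1])]
  exact hle s ⟨hs.1.le, hs.2⟩

/-! ### Passage to the limit in the contact point laws. -/

section Limit

variable {l : Filter ℝ} [l.NeBot]

/-- Derivative bound for a limit of functions with almost linear growth from `t` on. -/
theorem HasDerivAt.le_of_tendsto_of_eventually {y : ℝ → ℝ → ℝ} {f : ℝ → ℝ} {d m k t h : ℝ}
    (hl : l ≤ 𝓝 0) (ht : 0 ≤ t) (hy : ∀ s, 0 ≤ s → Tendsto (fun ε => y ε s) l (𝓝 (f s)))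
    (hf : HasDerivAt f d t) (hh : 0 < h)
    (hle : ∀ᶠ ε in l, ∀ s ∈ Icc t (t + h), y ε s - y ε t ≤ m * (s - t) + ε * k) : d ≤ m := by
  refine hf.le_of_sub_le_right hh fun s hs => ?_
  have h0 : Tendsto (fun ε : ℝ => m * (s - t) + ε * k) l (𝓝 (m * (s - t) + 0 * k)) :=
    (((continuous_const.add (continuous_id.mul continuous_const)).tendsto (0 : ℝ))).mono_left hl
  rw [zero_mul, add_zero] at h0
  refine le_of_tendsto_of_tendsto ((hy s (ht.trans hs.1)).sub (hy t ht)) h0 ?_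
  filter_upwards [hle] with ε hε using hε s hs

theorem ae_hasDerivAt_of_lipschitzOnWith {f : ℝ → ℝ} (hf : ∃ K, LipschitzOnWith K f (Ici 0)) :
    ∀ᵐ t, 0 ≤ t → HasDerivAt f (deriv f t) t := by
  obtain ⟨K, hK⟩ := hf
  have h0 : ∀ᵐ t : ℝ, t ≠ 0 := by simp [ae_iff]
  filter_upwards [hK.ae_differentiableWithinAt_of_mem_real, h0] with t ht h0 htn
  exact ((ht htn).differentiableAt (Ici_mem_nhds (lt_of_le_of_ne htn h0.symm))).hasDerivAt

theorem lipschitzOnWith_of_abs_sub_le {f : ℝ → ℝ} {M : ℝ} (hM : 0 ≤ M)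
    (h : ∀ s t, 0 ≤ s → s ≤ t → |f t - f s| ≤ M * (t - s)) :
    LipschitzOnWith ⟨M, hM⟩ f (Ici 0) := by
  refine LipschitzOnWith.of_dist_le_mul fun s hs t ht => ?_
  simp only [Real.dist_eq]
  change |f s - f t| ≤ M * |s - t|
  rcases le_total s t with hst | hst
  · rw [abs_sub_comm, abs_sub_comm s t, abs_of_nonneg (sub_nonneg.2 hst)]
    exact h s t hs hst
  · rw [abs_of_nonneg (sub_nonneg.2 hst)]
    exact h t s ht hst

/-- Limits of contact evolutions for the oscillating velocity laws are contact evolutions for the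
effective law. -/
theorem IsContactEvolution.of_tendsto {K : NNReal} {m M : ℝ} {a b : ℝ → ℝ} {aε bε : ℝ → ℝ → ℝ}
    (hQ : IsSlopeLaw QA QB w) (hr : HasSpeed β r C) (hrc : Continuous r)
    (hβ : LipschitzWith K β) (hB : ∀ x, |β x| ≤ B) (hl : l ≤ 𝓝[>] 0) (hm : 0 < m)
    (h : ∀ ε, 0 < ε → IsContactEvolution QA QB w (fun q x => q - β (x / ε)) (aε ε) (bε ε))
    (hmw : ∀ ε, 0 < ε → ∀ t, 0 ≤ t → m ≤ bε ε t - aε ε t)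
    (hMA : ∀ ε, 0 < ε → ∀ s t, 0 ≤ s → s ≤ t → |aε ε t - aε ε s| ≤ M * (t - s))
    (hMB : ∀ ε, 0 < ε → ∀ s t, 0 ≤ s → s ≤ t → |bε ε t - bε ε s| ≤ M * (t - s))
    (ha : ∀ t, 0 ≤ t → Tendsto (fun ε => aε ε t) l (𝓝 (a t)))
    (hb : ∀ t, 0 ≤ t → Tendsto (fun ε => bε ε t) l (𝓝 (b t))) :
    IsContactEvolution QA QB w (fun q _ => r q) a b := by
  have hl0 : l ≤ 𝓝 0 := hl.trans nhdsWithin_le_nhds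
  have hpos : ∀ᶠ ε in l, 0 < ε := hl self_mem_nhdsWithin
  have hM0 : 0 ≤ M := by
    have := (abs_nonneg _).trans (hMA 1 one_pos 0 1 le_rfl zero_le_one)
    linarith
  have hLA : LipschitzOnWith ⟨M, hM0⟩ a (Ici 0) := lipschitzOnWith_of_abs_sub_le hM0
    fun s t hs hst => le_of_tendsto ((ha t (hs.trans hst)).sub (ha s hs)).abs
      (hpos.mono fun ε hε => hMA ε hε s t hs hst)
  have hLB : LipschitzOnWith ⟨M, hM0⟩ b (Ici 0) := lipschitzOnWith_of_abs_sub_le hM0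
    fun s t hs hst => le_of_tendsto ((hb t (hs.trans hst)).sub (hb s hs)).abs
      (hpos.mono fun ε hε => hMB ε hε s t hs hst)
  have hwid : ∀ t, 0 ≤ t → b t - a t ∈ Ioc 0 w := fun t ht =>
    ⟨hm.trans_le (ge_of_tendsto ((hb t ht).sub (ha t ht)) (hpos.mono fun ε hε => hmw ε hε t ht)),
      le_of_tendsto ((hb t ht).sub (ha t ht))
        (hpos.mono fun ε hε => ((h ε hε).width_mem t ht).2)⟩
  -- the widths stay close to the limiting width for a short time
  have hnear : ∀ t, 0 ≤ t → ∀ δ, 0 < δ → ∃ η, 0 < η ∧ ∀ᶠ ε in l, ∀ s ∈ Icc t (t + η),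
      |bε ε s - aε ε s - (b t - a t)| < δ := by
    intro t ht δ hδ
    -- In this time each contact point moves by at most `δ / 4`. The other `δ / 2` is the distance
    -- to the limit at time `t`.
    refine ⟨δ / (4 * M + 1), by positivity, ?_⟩
    have h1 := Metric.tendsto_nhds.1 ((hb t ht).sub (ha t ht)) (δ / 2) (by positivity)
    filter_upwards [hpos, h1] with ε hε h2 s hs
    have i₁ := abs_le.1 (hMA ε hε t s ht hs.1)
    have i₂ := abs_le.1 (hMB ε hε t s ht hs.1)
    have i₃ : M * (s - t) ≤ δ / 4 := by
      have i₄ : (s - t) * (4 * M + 1) ≤ δ := by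
        rw [← le_div_iff₀ (by positivity)]; linarith [hs.2]
      linarith [hs.1]
    rw [Real.dist_eq, abs_lt] at h2
    rw [abs_lt]
    constructor <;> linarith
  -- the same for the squared slopes
  have hslope : ∀ Q : ℝ → ℝ, ContinuousOn Q (Ioc 0 w) → ∀ t, 0 ≤ t → ∀ η, 0 < η → ∃ δ, 0 < δ ∧
      ∀ᶠ ε in l, ∀ s ∈ Icc t (t + δ), |Q (bε ε s - aε ε s) - Q (b t - a t)| < η := by
    intro Q hQc t ht η hη
    obtain ⟨δ, hδ, hQδ⟩ := Metric.continuousOn_iff.1 hQc _ (hwid t ht) η hη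
    obtain ⟨δ', hδ', hev⟩ := hnear t ht δ hδ
    refine ⟨δ', hδ', ?_⟩
    filter_upwards [hpos, hev] with ε hε h1 s hs
    exact hQδ _ ((h ε hε).width_mem s (ht.trans hs.1)) (h1 s hs)
  have hrup : ∀ q η, 0 < η → ∃ δ, 0 < δ ∧ r (q + δ) ≤ r q + η ∧ r q - η ≤ r (q - δ) := by
    intro q η hη
    obtain ⟨δ, hδ, h1⟩ := Metric.continuous_iff.1 hrc q η hη
    have h2 := h1 (q + δ / 2) (by rw [Real.dist_eq, abs_lt]; constructor <;> linarith)
    have h3 := h1 (q - δ / 2) (by rw [Real.dist_eq, abs_lt]; constructor <;> linarith)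
    rw [Real.dist_eq, abs_lt] at h2 h3
    exact ⟨δ / 2, by positivity, by linarith, by linarith⟩
  refine ⟨⟨_, hLA⟩, ⟨_, hLB⟩, hwid, ?_, ?_⟩
  · filter_upwards [ae_hasDerivAt_of_lipschitzOnWith ⟨_, hLA⟩] with t hd ht
    refine ⟨_, hd ht, ?_, fun hlt => le_antisymm ?_ ?_⟩
    -- The upper bound comes first, as it alone uses `b t - a t < w`. The two remaining goals are
    -- the same lower bound, which holds at any width.
    rotate_left
    · refine le_of_forall_pos_le_add fun η hη => ?_
      obtain ⟨δ, hδ, -, hrδ⟩ := hrup (QA (b t - a t)) η hη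
      obtain ⟨η₁, hη₁, h1⟩ := hslope QA hQ.continuousA t ht δ hδ
      -- The approximating widths also stay below `w` for a short time, so their left laws are
      -- equalities there.
      obtain ⟨η₂, hη₂, h2⟩ := hnear t ht (w - (b t - a t)) (by linarith)
      refine (((hd ht).le_of_tendsto_of_eventually hl0 ht ha (lt_min hη₁ hη₂)
        (m := -r (QA (b t - a t) - δ)) (k := C (QA (b t - a t) - δ))) ?_).trans (by linarith)
      filter_upwards [hpos, h1, h2] with ε hε h1 h2 s hs
      refine hr.sub_le_of_backward hβ hB hε hs.1
        (LipschitzOnWith.absolutelyContinuousOnInterval_of_nonneg (h ε hε).lipschitzA ht hs.1) ?_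
      filter_upwards [(h ε hε).lawA] with σ hσ hσs
      obtain ⟨d, hd, -, heq⟩ := hσ (ht.trans hσs.1.le)
      have h1 := abs_lt.1 (h1 σ ⟨hσs.1.le, by linarith [hσs.2, hs.2, min_le_left η₁ η₂]⟩)
      have h2 := abs_lt.1 (h2 σ ⟨hσs.1.le, by linarith [hσs.2, hs.2, min_le_right η₁ η₂]⟩)
      have := heq (by linarith)
      exact ⟨d, hd, by linarith⟩
    all_goals
      refine le_of_forall_pos_le_add fun η hη => ?_
      obtain ⟨δ, hδ, hrδ, -⟩ := hrup (QA (b t - a t)) η hη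
      obtain ⟨η₁, hη₁, h1⟩ := hslope QA hQ.continuousA t ht δ hδ
      have := ((hd ht).neg.le_of_tendsto_of_eventually hl0 ht (y := fun ε s => -aε ε s)
        (fun s hs => (ha s hs).neg) hη₁
        (m := r (QA (b t - a t) + δ)) (k := C (QA (b t - a t) + δ))) (by
          filter_upwards [hpos, h1] with ε hε h1 s hs
          have := hr.le_sub_of_backward (q := QA (b t - a t) + δ) hβ hB hε hs.1
            (LipschitzOnWith.absolutelyContinuousOnInterval_of_nonneg (h ε hε).lipschitzA ht hs.1)
            (by
              filter_upwards [(h ε hε).lawA] with σ hσ hσs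
              obtain ⟨d, hd, hle, -⟩ := hσ (ht.trans hσs.1.le)
              have h1 := abs_lt.1 (h1 σ ⟨hσs.1.le, hσs.2.trans hs.2⟩)
              exact ⟨d, hd, by linarith⟩)
          linarith)
      linarith
  · filter_upwards [ae_hasDerivAt_of_lipschitzOnWith ⟨_, hLB⟩] with t hd ht
    have heq : deriv b t = r (QB (b t - a t)) := by
      apply le_antisymm
      · refine le_of_forall_pos_le_add fun η hη => ?_
        obtain ⟨δ, hδ, hrδ, -⟩ := hrup (QB (b t - a t)) η hη
        obtain ⟨η₁, hη₁, h1⟩ := hslope QB hQ.continuousB t ht δ hδ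
        refine (((hd ht).le_of_tendsto_of_eventually hl0 ht hb hη₁
          (m := r (QB (b t - a t) + δ)) (k := C (QB (b t - a t) + δ))) ?_).trans (by linarith)
        filter_upwards [hpos, h1] with ε hε h1 s hs
        refine hr.sub_le_of_forward hβ hB hε hs.1
          (LipschitzOnWith.absolutelyContinuousOnInterval_of_nonneg (h ε hε).lipschitzB ht hs.1) ?_
        filter_upwards [(h ε hε).lawB] with σ hσ hσs
        have h1 := abs_lt.1 (h1 σ ⟨hσs.1.le, hσs.2.trans hs.2⟩)
        exact ⟨_, hσ (ht.trans hσs.1.le), by linarith⟩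
      · refine le_of_forall_pos_le_add fun η hη => ?_
        obtain ⟨δ, hδ, -, hrδ⟩ := hrup (QB (b t - a t)) η hη
        obtain ⟨η₁, hη₁, h1⟩ := hslope QB hQ.continuousB t ht δ hδ
        have := ((hd ht).neg.le_of_tendsto_of_eventually hl0 ht (y := fun ε s => -bε ε s)
          (fun s hs => (hb s hs).neg) hη₁
          (m := -r (QB (b t - a t) - δ)) (k := C (QB (b t - a t) - δ))) (by
            filter_upwards [hpos, h1] with ε hε h1 s hs
            have := hr.le_sub_of_forward (q := QB (b t - a t) - δ) hβ hB hε hs.1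
              (LipschitzOnWith.absolutelyContinuousOnInterval_of_nonneg (h ε hε).lipschitzB ht
                hs.1) (by
              filter_upwards [(h ε hε).lawB] with σ hσ hσs
              have h1 := abs_lt.1 (h1 σ ⟨hσs.1.le, hσs.2.trans hs.2⟩)
              exact ⟨_, hσ (ht.trans hσs.1.le), by linarith⟩)
            linarith)
        linarith
    exact heq ▸ hd ht

end Limit

/-- Homogenization of the contact point dynamics. -/
theorem exists_tendsto_contactEvolution {K : NNReal} {a₀ b₀ : ℝ} {aε bε : ℝ → ℝ → ℝ}
    (hQ : IsSlopeLaw QA QB w) (hQB : ∀ ℓ ∈ Ioc 0 w, 0 ≤ QB ℓ)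
    (hr : HasSpeed β r C) (hrc : Continuous r) (hrm : Monotone r)
    (hβ : LipschitzWith K β) (hB : ∀ x, |β x| ≤ B)
    (h : ∀ ε, 0 < ε → IsContactEvolution QA QB w (fun q x => q - β (x / ε)) (aε ε) (bε ε))
    (ha0 : ∀ ε, 0 < ε → aε ε 0 = a₀) (hb0 : ∀ ε, 0 < ε → bε ε 0 = b₀) :
    ∃ a b : ℝ → ℝ, IsContactEvolution QA QB w (fun q _ => r q) a b ∧ a 0 = a₀ ∧ b 0 = b₀ ∧
      (∃ m, 0 < m ∧ ∀ ε, 0 < ε → ∀ t, 0 ≤ t → m ≤ bε ε t - aε ε t) ∧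
      ∀ T, TendstoUniformlyOn aε a (𝓝[>] 0) (Icc 0 T) ∧
        TendstoUniformlyOn bε b (𝓝[>] 0) (Icc 0 T) := by
  have hwid₀ : b₀ - a₀ ∈ Ioc 0 w := by
    rw [← ha0 1 one_pos, ← hb0 1 one_pos]
    exact (h 1 one_pos).width_mem 0 le_rfl
  obtain ⟨m₁, hm₁, hm₁B⟩ := hQ.unboundedB (2 * B)
  -- The lower barrier for the width must also lie below the initial width.
  set m := min m₁ (b₀ - a₀) with hmdef
  have hm : m ∈ Ioc 0 w := ⟨lt_min hm₁.1 hwid₀.1, (min_le_left _ _).trans hm₁.2⟩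
  have hmB : 2 * B ≤ QB m := hm₁B.trans (hQ.antitoneB hm hm₁ (min_le_left _ _))
  have hmw : ∀ ε, 0 < ε → ∀ t, 0 ≤ t → m ≤ bε ε t - aε ε t := fun ε hε t ht =>
    (h ε hε).le_width hQ hB hm hmB (by rw [ha0 ε hε, hb0 ε hε]; exact min_le_right _ _) ht
  set M := max (QA m + B) (QB m + B) with hM
  have hspeed : ∀ ε, 0 < ε → ∀ s t, 0 ≤ s → s ≤ t →
      |aε ε t - aε ε s| ≤ M * (t - s) ∧ |bε ε t - bε ε s| ≤ M * (t - s) := fun ε hε s t hs hst =>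
    (h ε hε).speed_le hQ hB hm (hmw ε hε) (le_max_left _ _) (le_max_right _ _) hQB hs hst
  have hM0 : 0 ≤ M := by
    have := (abs_nonneg _).trans (hspeed 1 one_pos 0 1 le_rfl zero_le_one).1
    linarith
  -- Along an ultrafilter bounded quantities converge, so pointwise limits exist at all times at
  -- once, without extracting subsequences.
  have hlim : ∀ 𝒰 : Ultrafilter ℝ, ↑𝒰 ≤ 𝓝[>] (0 : ℝ) → ∃ a b : ℝ → ℝ,
      IsContactEvolution QA QB w (fun q _ => r q) a b ∧ a 0 = a₀ ∧ b 0 = b₀ ∧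
      ∀ t, 0 ≤ t → Tendsto (fun ε => aε ε t) 𝒰 (𝓝 (a t)) ∧
        Tendsto (fun ε => bε ε t) 𝒰 (𝓝 (b t)) := by
    intro 𝒰 h𝒰
    have hpos : ∀ᶠ ε in (𝒰 : Filter ℝ), 0 < ε := h𝒰 self_mem_nhdsWithin
    have hex : ∀ (f : ℝ → ℝ → ℝ) (f₀ : ℝ), (∀ ε, 0 < ε → f ε 0 = f₀) →
        (∀ ε, 0 < ε → ∀ s t, 0 ≤ s → s ≤ t → |f ε t - f ε s| ≤ M * (t - s)) →
        ∃ g : ℝ → ℝ, ∀ t, 0 ≤ t → Tendsto (fun ε => f ε t) 𝒰 (𝓝 (g t)) := by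
      intro f f₀ hf0 hf
      have : ∀ t, ∃ x, 0 ≤ t → Tendsto (fun ε => f ε t) 𝒰 (𝓝 x) := by
        intro t
        by_cases ht : 0 ≤ t
        · have hmem : ∀ᶠ ε in (𝒰 : Filter ℝ), f ε t ∈ Icc (f₀ - M * t) (f₀ + M * t) := by
            filter_upwards [hpos] with ε hε
            have := abs_le.1 (hf ε hε 0 t le_rfl ht)
            rw [hf0 ε hε, sub_zero] at this
            constructor <;> linarith [this.1, this.2]
          obtain ⟨x, -, hx⟩ := isCompact_Icc.ultrafilter_le_nhds (𝒰.map fun ε => f ε t)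
            (le_principal_iff.2 hmem)
          exact ⟨x, fun _ => hx⟩
        · exact ⟨0, fun h => absurd h ht⟩
      choose g hg using this
      exact ⟨g, hg⟩
    obtain ⟨a, ha⟩ := hex aε a₀ ha0 fun ε hε s t hs hst => (hspeed ε hε s t hs hst).1
    obtain ⟨b, hb⟩ := hex bε b₀ hb0 fun ε hε s t hs hst => (hspeed ε hε s t hs hst).2
    refine ⟨a, b, IsContactEvolution.of_tendsto hQ hr hrc hβ hB h𝒰 hm.1 h hmw
      (fun ε hε s t hs hst => (hspeed ε hε s t hs hst).1)
      (fun ε hε s t hs hst => (hspeed ε hε s t hs hst).2) ha hb,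
      tendsto_nhds_unique (ha 0 le_rfl) ?_, tendsto_nhds_unique (hb 0 le_rfl) ?_,
      fun t ht => ⟨ha t ht, hb t ht⟩⟩
    · exact tendsto_const_nhds.congr' (hpos.mono fun ε hε => (ha0 ε hε).symm)
    · exact tendsto_const_nhds.congr' (hpos.mono fun ε hε => (hb0 ε hε).symm)
  obtain ⟨a, b, hab, ha0, hb0', -⟩ := hlim (Ultrafilter.of (𝓝[>] 0)) (Ultrafilter.of_le _)
  have hta : ∀ t, 0 ≤ t → Tendsto (fun ε => aε ε t) (𝓝[>] 0) (𝓝 (a t)) ∧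
      Tendsto (fun ε => bε ε t) (𝓝[>] 0) (𝓝 (b t)) := by
    intro t ht
    -- Uniqueness of the effective evolution makes the limit independent of the ultrafilter, which
    -- is convergence along the whole filter.
    simp only [tendsto_iff_ultrafilter _ (𝓝[>] (0 : ℝ))]
    refine forall₂_and.1 fun 𝒰 h𝒰 => ?_
    obtain ⟨a', b', hab', ha0', hb0'', hlim'⟩ := hlim 𝒰 h𝒰
    obtain ⟨e₁, e₂⟩ := hab'.eq hQ hrm hab (ha0'.trans ha0.symm) (hb0''.trans hb0'.symm) ht
    rw [← e₁, ← e₂]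
    exact hlim' t ht
  -- The common Lipschitz constant `M` upgrades pointwise convergence to uniform convergence on
  -- compact time intervals.
  have hunif : ∀ (f : ℝ → ℝ → ℝ) (g : ℝ → ℝ),
      (∀ ε, 0 < ε → ∀ s t, 0 ≤ s → s ≤ t → |f ε t - f ε s| ≤ M * (t - s)) →
      (∀ t, 0 ≤ t → Tendsto (fun ε => f ε t) (𝓝[>] 0) (𝓝 (g t))) →
      ∀ T, TendstoUniformlyOn f g (𝓝[>] 0) (Icc 0 T) := by
    intro f g hf hfg T
    have hpos : ∀ᶠ ε in 𝓝[>] (0 : ℝ), 0 < ε := self_mem_nhdsWithin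
    have hfL : ∀ ε, 0 < ε → ∀ s t, 0 ≤ s → 0 ≤ t → |f ε t - f ε s| ≤ M * |t - s| := by
      intro ε hε s t hs ht
      have := (lipschitzOnWith_of_abs_sub_le hM0 (hf ε hε)).dist_le_mul t ht s hs
      exact this
    have hgL : ∀ s t, 0 ≤ s → 0 ≤ t → |g t - g s| ≤ M * |t - s| := fun s t hs ht =>
      le_of_tendsto ((hfg t ht).sub (hfg s hs)).abs (hpos.mono fun ε hε => hfL ε hε s t hs ht)
    rw [← tendstoLocallyUniformlyOn_iff_tendstoUniformlyOn_of_compact isCompact_Icc,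
      Metric.tendstoLocallyUniformlyOn_iff]
    intro η hη t ht
    refine ⟨Metric.ball t (η / (4 * M + 1)) ∩ Icc 0 T, ?_, ?_⟩
    · exact inter_mem (mem_nhdsWithin_of_mem_nhds (Metric.ball_mem_nhds t (by positivity)))
        self_mem_nhdsWithin
    · filter_upwards [hpos, Metric.tendsto_nhds.1 (hfg t ht.1) (η / 2) (by positivity)]
        with ε hε h1 s hs
      have h2 := hfL ε hε s t hs.2.1 ht.1
      have h3 := hgL s t hs.2.1 ht.1
      have h4 : M * |t - s| ≤ η / 4 := by
        have h5 : |t - s| * (4 * M + 1) < η := by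
          rw [← lt_div_iff₀ (by positivity), abs_sub_comm]; exact hs.1
        nlinarith [abs_nonneg (t - s)]
      rw [Real.dist_eq, abs_lt] at *
      rw [abs_le] at h2 h3
      constructor <;> linarith [h2.1, h2.2, h3.1, h3.2, h1.1, h1.2]
  exact ⟨a, b, hab, ha0, hb0', ⟨m, hm.1, hmw⟩, fun T =>
    ⟨hunif aε a (fun ε hε s t hs hst => (hspeed ε hε s t hs hst).1) (fun t ht => (hta t ht).1) T,
      hunif bε b (fun ε hε s t hs hst => (hspeed ε hε s t hs hst).2) (fun t ht => (hta t ht).2) T⟩⟩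

/-! ### The function `s coth s - 1` -/

/-- The function `s coth s - 1`. -/
def cothGap (s : ℝ) : ℝ := s * Real.cosh s / Real.sinh s - 1

theorem Real.sinh_lt_mul_cosh {s : ℝ} (hs : 0 < s) : Real.sinh s < s * Real.cosh s := by
  have hmono : StrictMonoOn (fun s => s * Real.cosh s - Real.sinh s) (Ici 0) := by
    refine strictMonoOn_of_deriv_pos (convex_Ici 0) (by fun_prop) fun x hx => ?_
    rw [interior_Ici, mem_Ioi] at hx
    have h := ((hasDerivAt_id x).mul (Real.hasDerivAt_cosh x)).sub (Real.hasDerivAt_sinh x)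
    have h' : HasDerivAt (fun s => s * Real.cosh s - Real.sinh s)
      (1 * Real.cosh x + x * Real.sinh x - Real.cosh x) x := h
    rw [h'.deriv]
    have := mul_pos hx (Real.sinh_pos_iff.2 hx)
    linarith
  have := hmono (by simp) hs.le hs
  simp only [zero_mul, Real.sinh_zero, sub_zero] at this
  linarith

theorem cothGap_mul_sinh {s : ℝ} (hs : 0 < s) :
    cothGap s * Real.sinh s = s * Real.cosh s - Real.sinh s := by
  have := (Real.sinh_pos_iff.2 hs).ne'
  rw [cothGap]; field_simp

theorem cothGap_pos {s : ℝ} (hs : 0 < s) : 0 < cothGap s := by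
  have h1 := Real.sinh_lt_mul_cosh hs
  have h2 := cothGap_mul_sinh hs
  exact pos_of_mul_pos_left (by rw [h2]; linarith) (Real.sinh_pos_iff.2 hs).le

theorem continuousOn_cothGap : ContinuousOn cothGap (Ioi 0) := by
  refine ContinuousOn.sub (ContinuousOn.div (by fun_prop) (by fun_prop) fun s hs => ?_)
    continuousOn_const
  exact (Real.sinh_pos_iff.2 hs).ne'

/-- The numerator of the derivative is `sinh x * cosh x - x`, positive because `x < sinh x`. -/
theorem strictMonoOn_cothGap : StrictMonoOn cothGap (Ioi 0) := by
  refine strictMonoOn_of_deriv_pos (convex_Ioi 0) continuousOn_cothGap fun x hx => ?_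
  rw [interior_Ioi, mem_Ioi] at hx
  have hsh := Real.sinh_pos_iff.2 hx
  have h : HasDerivAt cothGap (((1 * Real.cosh x + x * Real.sinh x) * Real.sinh x -
      x * Real.cosh x * Real.cosh x) / Real.sinh x ^ 2) x :=
    ((((hasDerivAt_id x).mul (Real.hasDerivAt_cosh x)).div (Real.hasDerivAt_sinh x)
      hsh.ne').sub_const 1)
  rw [h.deriv]
  refine div_pos ?_ (by positivity)
  have h1 := Real.cosh_sq x
  have h2 := Real.self_lt_sinh_iff.2 hx
  have h3 := Real.one_le_cosh x
  nlinarith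

theorem cothGap_le {s : ℝ} (hs : 0 < s) : cothGap s ≤ s := by
  have hsh := Real.sinh_pos_iff.2 hs
  have h1 := cothGap_mul_sinh hs
  have h2 := Real.self_lt_sinh_iff.2 hs
  have h3 : Real.cosh s - Real.sinh s = Real.exp (-s) := Real.cosh_sub_sinh s
  have h4 : Real.exp (-s) ≤ 1 := by rw [Real.exp_le_one_iff]; linarith
  refine le_of_mul_le_mul_right ?_ hsh
  nlinarith

theorem sub_one_le_cothGap {s : ℝ} (hs : 0 < s) : s - 1 ≤ cothGap s := by
  have hsh := Real.sinh_pos_iff.2 hs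
  have h1 := cothGap_mul_sinh hs
  have h2 := Real.sinh_lt_cosh s
  refine le_of_mul_le_mul_right ?_ hsh
  nlinarith

theorem exists_cothGap_eq {G : ℝ} (hG : 0 < G) : ∃ s, 0 < s ∧ cothGap s = G := by
  obtain ⟨s, hs, h⟩ := intermediate_value_Icc (f := cothGap) (show G ≤ G + 1 by linarith)
    (continuousOn_cothGap.mono fun s hs => hG.trans_le hs.1)
    ⟨cothGap_le hG, by have := sub_one_le_cothGap (show 0 < G + 1 by linarith); linarith⟩
  exact ⟨s, hG.trans_le hs.1, h⟩

/-- `sinh` is convex on the half-line and vanishes at `0`, so it lies below its chord to `s`. -/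
theorem Real.mul_sinh_le_mul_sinh {z s : ℝ} (hz : 0 ≤ z) (hzs : z ≤ s) :
    s * Real.sinh z ≤ z * Real.sinh s := by
  rcases hz.eq_or_lt with rfl | hz
  · simp
  have hs := hz.trans_le hzs
  have hconv : ConvexOn ℝ (Ici 0) Real.sinh := by
    refine MonotoneOn.convexOn_of_deriv (convex_Ici 0) (by fun_prop)
      (Real.differentiable_sinh.differentiableOn) ?_
    rw [Real.deriv_sinh, interior_Ici]
    exact fun x hx y hy hxy => Real.cosh_le_cosh.2
      (by rwa [abs_of_pos hx, abs_of_pos hy])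
  have h := hconv.2 (show (0 : ℝ) ∈ Ici 0 by simp) (show s ∈ Ici 0 from hs.le)
    (show 0 ≤ 1 - z / s by rw [sub_nonneg, div_le_one hs]; exact hzs)
    (show 0 ≤ z / s by positivity) (by ring)
  simp only [smul_eq_mul, mul_zero, Real.sinh_zero, zero_add] at h
  rw [div_mul_cancel₀ _ hs.ne', div_mul_eq_mul_div, le_div_iff₀ hs] at h
  linarith

/-! ### Explicit drop profiles -/

section Shape

/-- The solution of the Euler-Lagrange equation on `(-ℓ/2, ℓ/2)` with zero boundary values and
volume `V`. -/
def dropShape (m τ V ℓ y : ℝ) : ℝ :=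
  τ * (y - ℓ / 2 * (Real.sinh (m * y) / Real.sinh (m * ℓ / 2))) +
    V * m * (Real.cosh (m * ℓ / 2) - Real.cosh (m * y)) /
      (2 * (cothGap (m * ℓ / 2) * Real.sinh (m * ℓ / 2)))

def dropShapeDeriv (m τ V ℓ y : ℝ) : ℝ :=
  τ * (1 - m * ℓ / 2 * (Real.cosh (m * y) / Real.sinh (m * ℓ / 2))) -
    V * m ^ 2 * Real.sinh (m * y) / (2 * (cothGap (m * ℓ / 2) * Real.sinh (m * ℓ / 2)))

/-- The slope of `dropShape` at the left contact point. -/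
def leftSlope (m τ V ℓ : ℝ) : ℝ := V * m ^ 2 / 2 / cothGap (m * ℓ / 2) - τ * cothGap (m * ℓ / 2)

/-- The slope of `dropShape` at the right contact point. -/
def rightSlope (m τ V ℓ : ℝ) : ℝ :=
  -(V * m ^ 2 / 2 / cothGap (m * ℓ / 2) + τ * cothGap (m * ℓ / 2))

variable {m τ V ℓ w : ℝ}

theorem hasDerivAt_dropShape (y : ℝ) :
    HasDerivAt (dropShape m τ V ℓ) (dropShapeDeriv m τ V ℓ y) y := by
  have h0 : HasDerivAt (fun y => m * y) m y := by simpa using (hasDerivAt_id y).const_mul m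
  have h1 := (((hasDerivAt_id y).sub
    ((h0.sinh.div_const (Real.sinh (m * ℓ / 2))).const_mul (ℓ / 2))).const_mul τ).add
    (((h0.cosh.const_sub (Real.cosh (m * ℓ / 2))).const_mul (V * m)).div_const
      (2 * (cothGap (m * ℓ / 2) * Real.sinh (m * ℓ / 2))))
  convert! h1 using 1
  rw [dropShapeDeriv]
  ring

/-- This is the Euler–Lagrange equation in centred coordinates. The constant term is the multiplier
of the volume constraint. -/
theorem hasDerivAt_dropShapeDeriv (y : ℝ) :
    HasDerivAt (dropShapeDeriv m τ V ℓ) (m ^ 2 * dropShape m τ V ℓ y - m ^ 2 * τ * y -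
      V * m ^ 3 * Real.cosh (m * ℓ / 2) /
        (2 * (cothGap (m * ℓ / 2) * Real.sinh (m * ℓ / 2)))) y := by
  have h0 : HasDerivAt (fun y => m * y) m y := by simpa using (hasDerivAt_id y).const_mul m
  have h1 := ((((h0.cosh.div_const (Real.sinh (m * ℓ / 2))).const_mul (m * ℓ / 2)).const_sub
    1).const_mul τ).sub ((h0.sinh.const_mul (V * m ^ 2)).div_const
      (2 * (cothGap (m * ℓ / 2) * Real.sinh (m * ℓ / 2))))
  convert! h1 using 1
  rw [dropShape]
  ring

theorem dropShape_left (hm : 0 < m) (hℓ : 0 < ℓ) : dropShape m τ V ℓ (-(ℓ / 2)) = 0 := by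
  have hs := (Real.sinh_pos_iff.2 (show 0 < m * ℓ / 2 by positivity)).ne'
  rw [dropShape, show m * -(ℓ / 2) = -(m * ℓ / 2) by ring, Real.sinh_neg, Real.cosh_neg]
  field_simp
  ring

theorem dropShape_right (hm : 0 < m) (hℓ : 0 < ℓ) : dropShape m τ V ℓ (ℓ / 2) = 0 := by
  have hs := (Real.sinh_pos_iff.2 (show 0 < m * ℓ / 2 by positivity)).ne'
  rw [dropShape, show m * (ℓ / 2) = m * ℓ / 2 by ring]
  field_simp
  ring

theorem dropShapeDeriv_left (hm : 0 < m) (hℓ : 0 < ℓ) :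
    dropShapeDeriv m τ V ℓ (-(ℓ / 2)) = leftSlope m τ V ℓ := by
  have hs0 : 0 < m * ℓ / 2 := by positivity
  have hs := (Real.sinh_pos_iff.2 hs0).ne'
  have hg := (cothGap_pos hs0).ne'
  have hc := cothGap_mul_sinh hs0
  rw [dropShapeDeriv, leftSlope, show m * -(ℓ / 2) = -(m * ℓ / 2) by ring, Real.sinh_neg,
    Real.cosh_neg]
  generalize m * ℓ / 2 = s at *
  have : s * (Real.cosh s / Real.sinh s) = cothGap s + 1 := by
    field_simp; linarith
  rw [this]
  field_simp
  ring

theorem dropShapeDeriv_right (hm : 0 < m) (hℓ : 0 < ℓ) :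
    dropShapeDeriv m τ V ℓ (ℓ / 2) = rightSlope m τ V ℓ := by
  have hs0 : 0 < m * ℓ / 2 := by positivity
  have hs := (Real.sinh_pos_iff.2 hs0).ne'
  have hg := (cothGap_pos hs0).ne'
  have hc := cothGap_mul_sinh hs0
  rw [dropShapeDeriv, rightSlope, show m * (ℓ / 2) = m * ℓ / 2 by ring]
  generalize m * ℓ / 2 = s at *
  have : s * (Real.cosh s / Real.sinh s) = cothGap s + 1 := by
    field_simp; linarith
  rw [this]
  field_simp
  ring

theorem integral_dropShape (hm : 0 < m) (hℓ : 0 < ℓ) :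
    ∫ y in (-(ℓ / 2))..(ℓ / 2), dropShape m τ V ℓ y = V := by
  have hs0 : 0 < m * ℓ / 2 := by positivity
  have hs := (Real.sinh_pos_iff.2 hs0).ne'
  have hg := (cothGap_pos hs0).ne'
  have hc := cothGap_mul_sinh hs0
  have hD : ∀ y, HasDerivAt (fun y => τ * (y ^ 2 / 2 - ℓ / 2 * (Real.cosh (m * y) / m /
      Real.sinh (m * ℓ / 2))) + V * m * (Real.cosh (m * ℓ / 2) * y - Real.sinh (m * y) / m) /
      (2 * (cothGap (m * ℓ / 2) * Real.sinh (m * ℓ / 2)))) (dropShape m τ V ℓ y) y := by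
    intro y
    have h0 : HasDerivAt (fun y => m * y) m y := by simpa using (hasDerivAt_id y).const_mul m
    have h1 := (((((hasDerivAt_id y).pow 2).div_const 2).sub
      (((h0.cosh.div_const m).div_const (Real.sinh (m * ℓ / 2))).const_mul (ℓ / 2))).const_mul
      τ).add ((((hasDerivAt_id y).const_mul (Real.cosh (m * ℓ / 2))).sub
        (h0.sinh.div_const m)).const_mul (V * m) |>.div_const
      (2 * (cothGap (m * ℓ / 2) * Real.sinh (m * ℓ / 2))))
    convert! h1 using 1
    rw [dropShape]
    simp only [id, Nat.cast_ofNat]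
    field_simp
    ring
  have hcont : Continuous (dropShape m τ V ℓ) :=
    continuous_iff_continuousAt.2 fun y => (hasDerivAt_dropShape y).continuousAt
  rw [intervalIntegral.integral_eq_sub_of_hasDerivAt (fun y _ => hD y)
    (hcont.intervalIntegrable _ _), show m * -(ℓ / 2) = -(m * ℓ / 2) by ring,
    show m * (ℓ / 2) = m * ℓ / 2 by ring, Real.sinh_neg, Real.cosh_neg, hc]
  have hN : m * ℓ / 2 * Real.cosh (m * ℓ / 2) - Real.sinh (m * ℓ / 2) ≠ 0 := by
    rw [← hc]; exact mul_ne_zero hg hs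
  have hm' := hm.ne'
  have e : V * m * (Real.cosh (m * ℓ / 2) * (ℓ / 2) - Real.sinh (m * ℓ / 2) / m) =
      V * (m * ℓ / 2 * Real.cosh (m * ℓ / 2) - Real.sinh (m * ℓ / 2)) := by
    field_simp
  have e' : V * m * (Real.cosh (m * ℓ / 2) * -(ℓ / 2) - -Real.sinh (m * ℓ / 2) / m) =
      -(V * (m * ℓ / 2 * Real.cosh (m * ℓ / 2) - Real.sinh (m * ℓ / 2))) := by
    field_simp; ring
  rw [e, e']
  generalize m * ℓ / 2 * Real.cosh (m * ℓ / 2) - Real.sinh (m * ℓ / 2) = N at *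
  field_simp
  ring

theorem continuousOn_dropShape (hm : 0 < m) :
    ContinuousOn (fun p : ℝ × ℝ => dropShape m τ V p.1 p.2) (Ioi 0 ×ˢ univ) := by
  have hpos : ∀ p ∈ (Ioi 0 ×ˢ univ : Set (ℝ × ℝ)), 0 < m * p.1 / 2 := by
    rintro p ⟨hp, -⟩
    have : 0 < p.1 := hp
    positivity
  have hs : ∀ p ∈ (Ioi 0 ×ˢ univ : Set (ℝ × ℝ)), Real.sinh (m * p.1 / 2) ≠ 0 :=
    fun p hp => (Real.sinh_pos_iff.2 (hpos p hp)).ne'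
  have hc : ContinuousOn (fun p : ℝ × ℝ => cothGap (m * p.1 / 2)) (Ioi 0 ×ˢ univ) :=
    continuousOn_cothGap.comp (by fun_prop) hpos
  unfold dropShape
  refine ContinuousOn.add (ContinuousOn.mul continuousOn_const (ContinuousOn.sub (by fun_prop)
    (ContinuousOn.mul (by fun_prop) (ContinuousOn.div (by fun_prop) (by fun_prop) hs))))
    (ContinuousOn.div (by fun_prop) (ContinuousOn.mul continuousOn_const
      (ContinuousOn.mul hc (by fun_prop))) fun p hp => ?_)
  exact mul_ne_zero two_ne_zero (mul_ne_zero (cothGap_pos (hpos p hp)).ne' (hs p hp))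

/-- The equation says that the two terms of `leftSlope` cancel at `w`. -/
theorem exists_maximal_width (hm : 0 < m) (hτ : 0 < τ) (hV : 0 < V) :
    ∃ w, 0 < w ∧ τ * cothGap (m * w / 2) ^ 2 = V * m ^ 2 / 2 := by
  have hpos : 0 < V * m ^ 2 / 2 / τ := by positivity
  obtain ⟨s, hs, hsG⟩ := exists_cothGap_eq (Real.sqrt_pos.2 hpos)
  refine ⟨2 * s / m, by positivity, ?_⟩
  rw [show m * (2 * s / m) / 2 = s by field_simp, hsG, Real.sq_sqrt hpos.le]
  field_simp

theorem cothGap_mono (hm : 0 < m) (hℓ : 0 < ℓ) (h : ℓ ≤ w) :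
    cothGap (m * ℓ / 2) ≤ cothGap (m * w / 2) :=
  strictMonoOn_cothGap.monotoneOn (show 0 < m * ℓ / 2 by positivity)
    (show 0 < m * w / 2 by have := hℓ.trans_le h; positivity) (by gcongr)

theorem cothGap_lt (hm : 0 < m) (hℓ : 0 < ℓ) (h : ℓ < w) :
    cothGap (m * ℓ / 2) < cothGap (m * w / 2) :=
  strictMonoOn_cothGap (show 0 < m * ℓ / 2 by positivity)
    (show 0 < m * w / 2 by have := hℓ.trans h; positivity) (by gcongr)

theorem leftSlope_eq_zero (hm : 0 < m) (hw : 0 < w)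
    (hwV : τ * cothGap (m * w / 2) ^ 2 = V * m ^ 2 / 2) : leftSlope m τ V w = 0 := by
  have := (cothGap_pos (show 0 < m * w / 2 by positivity)).ne'
  rw [leftSlope, ← hwV]
  field_simp
  ring

theorem leftSlope_strictAnti (hm : 0 < m) (hτ : 0 < τ) (hV : 0 < V) :
    StrictAntiOn (leftSlope m τ V) (Ioi 0) := by
  intro x hx y hy hxy
  have hx : 0 < x := hx
  have h1 := cothGap_lt hm hx hxy
  have h2 := cothGap_pos (show 0 < m * x / 2 by positivity)
  rw [leftSlope, leftSlope]
  have : V * m ^ 2 / 2 / cothGap (m * y / 2) ≤ V * m ^ 2 / 2 / cothGap (m * x / 2) := by gcongr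
  nlinarith

theorem leftSlope_pos (hm : 0 < m) (hτ : 0 < τ) (hV : 0 < V) (hℓ : 0 < ℓ) (hℓw : ℓ < w)
    (hwV : τ * cothGap (m * w / 2) ^ 2 = V * m ^ 2 / 2) : 0 < leftSlope m τ V ℓ := by
  rw [← leftSlope_eq_zero hm (hℓ.trans hℓw) hwV]
  exact leftSlope_strictAnti hm hτ hV hℓ (hℓ.trans hℓw) hℓw

theorem rightSlope_neg (hm : 0 < m) (hτ : 0 < τ) (hV : 0 < V) (hℓ : 0 < ℓ) :
    rightSlope m τ V ℓ < 0 := by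
  have := cothGap_pos (show 0 < m * ℓ / 2 by positivity)
  rw [rightSlope, neg_lt_zero]
  positivity

theorem continuousOn_cothGap_width (hm : 0 < m) :
    ContinuousOn (fun ℓ => cothGap (m * ℓ / 2)) (Ioi 0) :=
  continuousOn_cothGap.comp (by fun_prop) fun ℓ (hℓ : 0 < ℓ) =>
    show 0 < m * ℓ / 2 by positivity

/-- With `g` the `cothGap` at `ℓ`, `G` its value at `w` and `k = V * m ^ 2 / 2 = τ * G ^ 2`, the
slopes are `k / g - τ * g` and `-(k / g + τ * g)`. The function `k / g + τ * g` decreases exactly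
for `g ≤ G`, that is, up to the maximal width. -/
theorem isSlopeLaw (hm : 0 < m) (hτ : 0 < τ) (hV : 0 < V) (hw : 0 < w)
    (hwV : τ * cothGap (m * w / 2) ^ 2 = V * m ^ 2 / 2) :
    IsSlopeLaw (fun ℓ => leftSlope m τ V ℓ ^ 2 / 2) (fun ℓ => rightSlope m τ V ℓ ^ 2 / 2) w where
  antitoneA := by
    intro x hx y hy hxy
    have h1 := (leftSlope_strictAnti hm hτ hV).antitoneOn hx.1 hy.1 hxy
    have h2 : 0 ≤ leftSlope m τ V y := by
      rw [← leftSlope_eq_zero hm hw hwV]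
      exact (leftSlope_strictAnti hm hτ hV).antitoneOn hy.1 hw hy.2
    dsimp only
    gcongr
  antitoneB := by
    intro x hx y hy hxy
    have g1 := cothGap_pos (show 0 < m * x / 2 by have := hx.1; positivity)
    have g2 := cothGap_mono hm hx.1 hxy
    have g3 := cothGap_mono hm hy.1 hy.2
    have h2 : 0 ≤ -rightSlope m τ V y := by
      have := rightSlope_neg (V := V) hm hτ hV hy.1; linarith
    have h1 : -rightSlope m τ V y ≤ -rightSlope m τ V x := by
      rw [rightSlope, rightSlope, neg_neg, neg_neg, ← hwV]
      generalize cothGap (m * x / 2) = p at *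
      generalize cothGap (m * y / 2) = q at *
      generalize cothGap (m * w / 2) = G at *
      have hq : 0 < q := by linarith
      have : τ * G ^ 2 / p + τ * p - (τ * G ^ 2 / q + τ * q) =
          τ * (q - p) * (G ^ 2 - p * q) / (p * q) := by field_simp; ring
      have h3 : p * q ≤ G ^ 2 := by nlinarith
      have h4 : 0 ≤ τ * (q - p) * (G ^ 2 - p * q) / (p * q) :=
        div_nonneg (mul_nonneg (mul_nonneg hτ.le (by linarith)) (by linarith)) (by positivity)
      linarith
    dsimp only
    rw [← neg_sq (rightSlope m τ V y), ← neg_sq (rightSlope m τ V x)]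
    gcongr
  continuousA := by
    have hc := (continuousOn_cothGap_width hm).mono (fun ℓ (hℓ : ℓ ∈ Ioc 0 w) => hℓ.1)
    unfold leftSlope
    refine ((ContinuousOn.sub (continuousOn_const.div hc fun ℓ hℓ => ?_)
      (continuousOn_const.mul hc)).pow 2).div_const 2
    exact (cothGap_pos (show 0 < m * ℓ / 2 by have := hℓ.1; positivity)).ne'
  continuousB := by
    have hc := (continuousOn_cothGap_width hm).mono (fun ℓ (hℓ : ℓ ∈ Ioc 0 w) => hℓ.1)
    unfold rightSlope
    refine ((ContinuousOn.add (continuousOn_const.div hc fun ℓ hℓ => ?_)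
      (continuousOn_const.mul hc)).neg.pow 2).div_const 2
    exact (cothGap_pos (show 0 < m * ℓ / 2 by have := hℓ.1; positivity)).ne'
  nonnegA := fun ℓ _ => by positivity
  unboundedB := by
    intro C
    set k := V * m ^ 2 / 2 with hk
    have hk0 : 0 < k := by positivity
    -- As `cothGap s ≤ s`, this width makes `k / cothGap` at least `|C| + 2`, and half the square of
    -- the slope then exceeds `C`.
    set ℓ := min w (2 * (k / (|C| + 2)) / m) with hℓ
    have hℓ0 : 0 < ℓ := lt_min hw (by positivity)
    refine ⟨ℓ, ⟨hℓ0, min_le_left _ _⟩, ?_⟩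
    have hs0 : 0 < m * ℓ / 2 := by positivity
    have hg0 := cothGap_pos hs0
    have h1 : cothGap (m * ℓ / 2) ≤ k / (|C| + 2) := by
      refine (cothGap_le hs0).trans ?_
      have : ℓ * m ≤ 2 * (k / (|C| + 2)) := by
        rw [← le_div_iff₀ hm]; exact min_le_right _ _
      linarith
    have h2 : |C| + 2 ≤ k / cothGap (m * ℓ / 2) := by
      rw [le_div_iff₀ hg0]
      rw [le_div_iff₀ (by positivity)] at h1
      linarith
    have h3 : |C| + 2 ≤ -rightSlope m τ V ℓ := by
      rw [rightSlope, neg_neg]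
      have := mul_pos hτ hg0
      linarith
    nlinarith [abs_nonneg C, le_abs_self C]

/-- The symmetric part is positive, and on the right half the odd part is nonnegative by convexity
of `sinh`. On the left half the odd part is negative, and `ℓ ≤ w` enters as a lower bound for the
coefficient of the symmetric part. -/
theorem dropShape_pos (hm : 0 < m) (hτ : 0 < τ) (hV : 0 < V) (hℓ : 0 < ℓ) (hℓw : ℓ ≤ w)
    (hwV : τ * cothGap (m * w / 2) ^ 2 = V * m ^ 2 / 2) {y : ℝ} (hy : y ∈ Ioo (-(ℓ / 2)) (ℓ / 2)) :
    0 < dropShape m τ V ℓ y := by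
  have hs0 : 0 < m * ℓ / 2 := by positivity
  have hsh := Real.sinh_pos_iff.2 hs0
  have hg := cothGap_pos hs0
  have hgw := cothGap_mono hm hℓ hℓw
  have hgV : τ * cothGap (m * ℓ / 2) ^ 2 ≤ V * m ^ 2 / 2 := by rw [← hwV]; gcongr
  have hc := cothGap_mul_sinh hs0
  have hz1 : -(m * ℓ / 2) < m * y := by nlinarith [hy.1]
  have hz2 : m * y < m * ℓ / 2 := by nlinarith [hy.2]
  have hcosh : Real.cosh (m * y) < Real.cosh (m * ℓ / 2) := by
    rw [Real.cosh_lt_cosh, abs_of_pos hs0, abs_lt]; exact ⟨hz1, hz2⟩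
  have hscale : dropShape m τ V ℓ y = (τ * (m * y * Real.sinh (m * ℓ / 2) -
      m * ℓ / 2 * Real.sinh (m * y)) + V * m ^ 2 / 2 / cothGap (m * ℓ / 2) *
      (Real.cosh (m * ℓ / 2) - Real.cosh (m * y))) / (m * Real.sinh (m * ℓ / 2)) := by
    have h1 := hsh.ne'
    have h2 := hg.ne'
    rw [dropShape]
    generalize Real.sinh (m * ℓ / 2) = S at *
    generalize cothGap (m * ℓ / 2) = g at *
    field_simp
  rw [hscale]
  refine div_pos ?_ (by positivity)
  generalize m * y = z at *
  generalize m * ℓ / 2 = s at *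
  rcases le_or_gt 0 z with hz | hz
  · have h1 := Real.mul_sinh_le_mul_sinh hz hz2.le
    have h2 : 0 < V * m ^ 2 / 2 / cothGap s * (Real.cosh s - Real.cosh z) :=
      mul_pos (by positivity) (by linarith)
    nlinarith
  · have hlow : τ * cothGap s ≤ V * m ^ 2 / 2 / cothGap s := by
      rw [le_div_iff₀ hg]; linarith
    -- With `ζ = -z` this is the profile for the smallest admissible coefficient, divided by `τ` up
    -- to a positive factor. It vanishes at `ζ = s`, so strict decrease gives positivity.
    have hanti : StrictAntiOn (fun ζ => cothGap s * (Real.cosh s - Real.cosh ζ) -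
        ζ * Real.sinh s + s * Real.sinh ζ) (Icc 0 s) := by
      refine strictAntiOn_of_deriv_neg (convex_Icc 0 s) (by fun_prop) fun ζ hζ => ?_
      rw [interior_Icc] at hζ
      have hd : HasDerivAt (fun ζ => cothGap s * (Real.cosh s - Real.cosh ζ) -
          ζ * Real.sinh s + s * Real.sinh ζ)
          (cothGap s * (-Real.sinh ζ) - 1 * Real.sinh s + s * Real.cosh ζ) ζ :=
        (((((Real.hasDerivAt_cosh ζ).const_sub _).const_mul _).sub
          ((hasDerivAt_id ζ).mul_const _)).add ((Real.hasDerivAt_sinh ζ).const_mul s))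
      rw [hd.deriv]
      -- After multiplication by `sinh s`, negativity of the derivative reads `s * sinh (s - ζ) <
      -- sinh s * (sinh s - sinh ζ)`. In terms of `p` and `q` both sides contain the factor `2 *
      -- sinh p`, leaving `s * cosh p < sinh s * cosh q`.
      set p := (s - ζ) / 2 with hp
      set q := (s + ζ) / 2 with hq
      have hsp : s = q + p := by rw [hp, hq]; ring
      have hζp : ζ = q - p := by rw [hp, hq]; ring
      have hp0 : 0 < p := by rw [hp]; linarith [hζ.2]
      have hpq : p ≤ q := by rw [hp, hq]; linarith [hζ.1]
      have hcpq : Real.cosh p ≤ Real.cosh q := by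
        rw [Real.cosh_le_cosh, abs_of_pos hp0, abs_of_pos (by linarith)]; exact hpq
      have hself := Real.self_lt_sinh_iff.2 hs0
      have hshp := Real.sinh_pos_iff.2 hp0
      have key : s * Real.cosh p < Real.sinh s * Real.cosh q := by
        have := Real.cosh_pos p
        nlinarith
      have e1 : s * Real.sinh (s - ζ) < Real.sinh s * (Real.sinh s - Real.sinh ζ) := by
        have a1 : Real.sinh (s - ζ) = 2 * Real.sinh p * Real.cosh p := by
          rw [show s - ζ = 2 * p by rw [hp]; ring, Real.sinh_two_mul]
        have a2 : Real.sinh s - Real.sinh ζ = 2 * Real.cosh q * Real.sinh p := by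
          rw [hζp]
          nth_rewrite 1 [hsp]
          rw [Real.sinh_add, Real.sinh_sub]; ring
        rw [a1, a2]
        nlinarith
      rw [Real.sinh_sub] at e1
      have : (cothGap s * (-Real.sinh ζ) - 1 * Real.sinh s + s * Real.cosh ζ) * Real.sinh s < 0 := by
        have : cothGap s * (-Real.sinh ζ) * Real.sinh s =
          -Real.sinh ζ * (s * Real.cosh s - Real.sinh s) := by rw [← hc]; ring
        nlinarith
      exact neg_of_mul_neg_left this hsh.le
    have h1 := hanti (show -z ∈ Icc 0 s from ⟨by linarith, by linarith⟩) ⟨hs0.le, le_rfl⟩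
      (by linarith)
    simp only [Real.sinh_neg, Real.cosh_neg, sub_self, mul_zero] at h1
    have h2 : 0 < τ * (cothGap s * (Real.cosh s - Real.cosh z) + z * Real.sinh s -
      s * Real.sinh z) := mul_pos hτ (by linarith)
    have h3 : τ * cothGap s * (Real.cosh s - Real.cosh z) ≤
        V * m ^ 2 / 2 / cothGap s * (Real.cosh s - Real.cosh z) :=
      mul_le_mul_of_nonneg_right hlow (by linarith)
    linarith

/-- Sign of the multiplier at the left end of a drop of maximal width. -/
theorem mul_coth_le_of_maximal_width (hm : 0 < m) (hτ : 0 < τ) (hw : 0 < w)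
    (hwV : τ * cothGap (m * w / 2) ^ 2 = V * m ^ 2 / 2) :
    V * m ^ 3 * Real.cosh (m * w / 2) /
        (2 * (cothGap (m * w / 2) * Real.sinh (m * w / 2))) ≤ m ^ 2 * τ * (w / 2) := by
  have hs0 : 0 < m * w / 2 := by positivity
  have hsh := Real.sinh_pos_iff.2 hs0
  have hg := cothGap_pos hs0
  have hc := cothGap_mul_sinh hs0
  have hself := Real.self_lt_sinh_iff.2 hs0
  have hcosh := Real.one_le_cosh (m * w / 2)
  have hsq := Real.cosh_sq (m * w / 2)
  rw [show V * m ^ 3 = 2 * m * (V * m ^ 2 / 2) by ring, ← hwV,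
    show m ^ 2 * τ * (w / 2) = m * τ * (m * w / 2) by ring]
  generalize m * w / 2 = s at *
  rw [div_le_iff₀ (by positivity)]
  -- Multiplied by `sinh s`, this amounts to `s ≤ sinh s * cosh s`.
  have h1 : cothGap s * Real.cosh s ≤ s * Real.sinh s := by
    refine le_of_mul_le_mul_right ?_ hsh
    have : cothGap s * Real.cosh s * Real.sinh s =
      Real.cosh s * (s * Real.cosh s - Real.sinh s) := by rw [← hc]; ring
    rw [this]
    nlinarith
  have h2 : 0 < m * τ * cothGap s := by positivity
  nlinarith

end Shape

/-! ### Functions in `H₀¹` -/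

section MemH10

variable {a b : ℝ} {v u : ℝ → ℝ}

theorem MemH10.eq_zero_of_le (h : b ≤ a) (hv : MemH10 a b v) : v = 0 :=
  funext fun x => hv.eq_zero x (by simp [h])

theorem MemH10.continuous (hv : MemH10 a b v) : Continuous v := by
  rcases le_or_gt b a with hab | hab
  · rw [hv.eq_zero_of_le hab]; exact continuous_const
  have hc : ContinuousOn v (Icc a b) := by
    simpa [uIcc_of_le hab.le] using hv.absCont.continuousOn
  have heq : v = IccExtend hab.le ((Icc a b).domRestrict v) := by
    funext x
    rcases le_or_gt x a with hx | hx
    · rw [IccExtend_of_le_left _ _ hx, hv.eq_zero x (by simp [hx])]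
      exact (hv.eq_zero a (by simp)).symm
    rcases le_or_gt b x with hx' | hx'
    · rw [IccExtend_of_right_le _ _ hx', hv.eq_zero x (by simp [hx'])]
      exact (hv.eq_zero b (by simp)).symm
    · rw [IccExtend_of_mem _ _ ⟨hx.le, hx'.le⟩]; rfl
  rw [heq]
  exact (continuousOn_iff_continuous_domRestrict.1 hc).Icc_extend'

theorem MemH10.hasCompactSupport (hv : MemH10 a b v) : HasCompactSupport v :=
  HasCompactSupport.intro (isCompact_Icc (a := a) (b := b)) fun x hx =>
    hv.eq_zero x fun h => hx (Ioo_subset_Icc_self h)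

theorem MemH10.deriv_eq_zero (hv : MemH10 a b v) {x : ℝ} (hx : x ∉ Icc a b) : deriv v x = 0 := by
  have : v =ᶠ[𝓝 x] fun _ => 0 := by
    filter_upwards [isClosed_Icc.isOpen_compl.mem_nhds hx] with y hy
    exact hv.eq_zero y fun h => hy (Ioo_subset_Icc_self h)
  rw [this.deriv_eq, deriv_const]

theorem MemH10.integrable (hv : MemH10 a b v) : Integrable v :=
  hv.continuous.integrable_of_hasCompactSupport hv.hasCompactSupport

theorem MemH10.integrable_mul (hv : MemH10 a b v) {f : ℝ → ℝ} (hf : Continuous f) :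
    Integrable (fun x => f x * v x) :=
  (hf.mul hv.continuous).integrable_of_hasCompactSupport hv.hasCompactSupport.mul_left

theorem MemH10.integrable_deriv_mul (hv : MemH10 a b v) (hu : MemH10 a b u) :
    Integrable (fun x => deriv v x * deriv u x) :=
  hv.memLp_deriv.integrable_mul hu.memLp_deriv

theorem MemH10.of_lipschitzWith {K : NNReal} (hv : LipschitzWith K v)
    (h0 : ∀ x ∉ Ioo a b, v x = 0) : MemH10 a b v := by
  refine ⟨(hv.lipschitzOnWith (s := uIcc a b)).absolutelyContinuousOnInterval, ?_, h0⟩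
  have hz : ∀ x ∉ Icc a b, deriv v x = 0 := by
    intro x hx
    have : v =ᶠ[𝓝 x] fun _ => 0 := by
      filter_upwards [isClosed_Icc.isOpen_compl.mem_nhds hx] with y hy
      exact h0 y fun h => hy (Ioo_subset_Icc_self h)
    rw [this.deriv_eq, deriv_const]
  have hind : deriv v = (Icc a b).indicator (deriv v) := by
    funext x
    by_cases hx : x ∈ Icc a b
    · rw [indicator_of_mem hx]
    · rw [indicator_of_notMem hx, hz x hx]
  rw [hind, memLp_indicator_iff_restrict measurableSet_Icc]
  exact MemLp.of_bound (measurable_deriv v).aestronglyMeasurable K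
    (ae_of_all _ fun x => norm_deriv_le_of_lipschitz hv)

theorem integral_eq_intervalIntegral_of_eq_zero {f : ℝ → ℝ} (hab : a ≤ b)
    (h0 : ∀ x ∉ Icc a b, f x = 0) : ∫ x, f x = ∫ x in a..b, f x := by
  rw [intervalIntegral.integral_of_le hab, ← integral_Icc_eq_integral_Ioc,
    setIntegral_eq_integral_of_forall_compl_eq_zero h0]

end MemH10

/-! ### Drop profiles on an interval -/

/-- The explicit drop profile with support `[a, b]`. -/
def dropProfile (m τ V a b x : ℝ) : ℝ :=
  dropShape m τ V (b - a) (max (-((b - a) / 2)) (min ((b - a) / 2) (x - (a + b) / 2)))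

section Profile

variable {m τ V a b w x : ℝ}

theorem dropProfile_of_mem (hx : x ∈ Icc a b) :
    dropProfile m τ V a b x = dropShape m τ V (b - a) (x - (a + b) / 2) := by
  rw [dropProfile, min_eq_right (by linarith [hx.2]), max_eq_right (by linarith [hx.1])]

theorem dropProfile_of_notMem (hm : 0 < m) (hab : a < b) (hx : x ∉ Ioo a b) :
    dropProfile m τ V a b x = 0 := by
  rw [mem_Ioo, not_and_or, not_lt, not_lt] at hx
  rcases hx with hx | hx
  · rw [dropProfile, min_eq_right (by linarith), max_eq_left (by linarith)]
    exact dropShape_left hm (sub_pos.2 hab)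
  · rw [dropProfile, min_eq_left (by linarith), max_eq_right (by linarith)]
    exact dropShape_right hm (sub_pos.2 hab)

theorem hasDerivAt_dropShape_sub (x : ℝ) :
    HasDerivAt (fun x => dropShape m τ V (b - a) (x - (a + b) / 2))
      (dropShapeDeriv m τ V (b - a) (x - (a + b) / 2)) x :=
  (hasDerivAt_dropShape (x - (a + b) / 2)).comp_sub_const x ((a + b) / 2)

theorem hasDerivAt_dropProfile (hx : x ∈ Ioo a b) :
    HasDerivAt (dropProfile m τ V a b) (dropShapeDeriv m τ V (b - a) (x - (a + b) / 2)) x := by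
  refine (hasDerivAt_dropShape_sub x).congr_of_eventuallyEq ?_
  filter_upwards [Icc_mem_nhds hx.1 hx.2] with y hy using dropProfile_of_mem hy

theorem hasDerivWithinAt_dropProfile_left (hm : 0 < m) (hab : a < b) :
    HasDerivWithinAt (dropProfile m τ V a b) (leftSlope m τ V (b - a)) (Ici a) a := by
  have h := (hasDerivAt_dropShape_sub (m := m) (τ := τ) (V := V) (a := a) (b := b)
    a).hasDerivWithinAt (s := Icc a b)
  rw [show a - (a + b) / 2 = -((b - a) / 2) by ring, dropShapeDeriv_left hm (sub_pos.2 hab)] at h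
  exact (h.congr (fun x hx => dropProfile_of_mem hx)
    (dropProfile_of_mem ⟨le_rfl, hab.le⟩)).mono_of_mem_nhdsWithin (Icc_mem_nhdsGE hab)

theorem hasDerivWithinAt_dropProfile_right (hm : 0 < m) (hab : a < b) :
    HasDerivWithinAt (dropProfile m τ V a b) (rightSlope m τ V (b - a)) (Iic b) b := by
  have h := (hasDerivAt_dropShape_sub (m := m) (τ := τ) (V := V) (a := a) (b := b)
    b).hasDerivWithinAt (s := Icc a b)
  rw [show b - (a + b) / 2 = (b - a) / 2 by ring, dropShapeDeriv_right hm (sub_pos.2 hab)] at h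
  exact (h.congr (fun x hx => dropProfile_of_mem hx)
    (dropProfile_of_mem ⟨hab.le, le_rfl⟩)).mono_of_mem_nhdsWithin (Icc_mem_nhdsLE hab)

/-- Clamping is 1-Lipschitz jointly in the half-width and the position, so estimates for `dropShape`
carry over to profiles extended by zero, even with different supports. -/
theorem abs_clamp_sub_clamp_le (p q y z : ℝ) :
    |max (-p) (min p y) - max (-q) (min q z)| ≤ max |p - q| |y - z| := by
  refine (abs_max_sub_max_le_max _ _ _ _).trans (max_le ?_ (abs_min_sub_min_le_max _ _ _ _))
  rw [neg_sub_neg, abs_sub_comm]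
  exact le_max_left _ _

theorem clamp_mem {p : ℝ} (hp : 0 ≤ p) (y : ℝ) : max (-p) (min p y) ∈ Icc (-p) p :=
  ⟨le_max_left _ _, max_le (by linarith) (min_le_left _ _)⟩

theorem contDiff_dropShape (n : WithTop ℕ∞) (ℓ : ℝ) : ContDiff ℝ n (dropShape m τ V ℓ) := by
  unfold dropShape
  fun_prop

theorem contDiff_dropShapeDeriv (n : WithTop ℕ∞) (ℓ : ℝ) :
    ContDiff ℝ n (dropShapeDeriv m τ V ℓ) := by
  unfold dropShapeDeriv
  fun_prop

theorem exists_lipschitzWith_dropProfile (hab : a < b) :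
    ∃ K, LipschitzWith K (dropProfile m τ V a b) := by
  obtain ⟨K, hK⟩ := ((contDiff_dropShape (m := m) (τ := τ) (V := V) 1
    (b - a)).contDiffOn (s := Icc (-((b - a) / 2)) ((b - a) / 2))).exists_lipschitzOnWith
      one_ne_zero (convex_Icc _ _) isCompact_Icc
  refine ⟨K, LipschitzWith.of_dist_le_mul fun x y => ?_⟩
  refine (hK.dist_le_mul _ (clamp_mem (by linarith) _) _ (clamp_mem (by linarith) _)).trans ?_
  gcongr
  have := abs_clamp_sub_clamp_le ((b - a) / 2) ((b - a) / 2) (x - (a + b) / 2) (y - (a + b) / 2)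
  simpa [Real.dist_eq] using this

theorem memH10_dropProfile {a' : ℝ} (hm : 0 < m) (hab : a < b) (ha' : a' ≤ a) :
    MemH10 a' b (dropProfile m τ V a b) := by
  obtain ⟨K, hK⟩ := exists_lipschitzWith_dropProfile (m := m) (τ := τ) (V := V) hab
  exact MemH10.of_lipschitzWith hK fun x hx => dropProfile_of_notMem hm hab
    fun h => hx ⟨ha'.trans_lt h.1, h.2⟩

theorem integral_dropProfile (hm : 0 < m) (hab : a < b) :
    ∫ x, dropProfile m τ V a b x = V := by
  rw [integral_eq_intervalIntegral_of_eq_zero hab.le fun x hx =>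
    dropProfile_of_notMem hm hab fun h => hx (Ioo_subset_Icc_self h)]
  have h1 : ∫ x in a..b, dropProfile m τ V a b x =
      ∫ x in a..b, dropShape m τ V (b - a) (x - (a + b) / 2) :=
    intervalIntegral.integral_congr fun x hx =>
      dropProfile_of_mem (by rwa [uIcc_of_le hab.le] at hx)
  rw [h1, intervalIntegral.integral_comp_sub_right (fun y => dropShape m τ V (b - a) y),
    show a - (a + b) / 2 = -((b - a) / 2) by ring, show b - (a + b) / 2 = (b - a) / 2 by ring]
  exact integral_dropShape hm (sub_pos.2 hab)

theorem dropProfile_pos (hm : 0 < m) (hτ : 0 < τ) (hV : 0 < V) (hℓw : b - a ≤ w)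
    (hwV : τ * cothGap (m * w / 2) ^ 2 = V * m ^ 2 / 2) (hx : x ∈ Ioo a b) :
    0 < dropProfile m τ V a b x := by
  rw [dropProfile_of_mem (Ioo_subset_Icc_self hx)]
  exact dropShape_pos hm hτ hV (by linarith [hx.1, hx.2]) hℓw hwV
    ⟨by linarith [hx.1], by linarith [hx.2]⟩

theorem dropProfile_mem_dropProfiles {a' : ℝ} (hm : 0 < m) (hτ : 0 < τ) (hV : 0 < V)
    (hab : a < b) (hℓw : b - a ≤ w) (hwV : τ * cothGap (m * w / 2) ^ 2 = V * m ^ 2 / 2)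
    (ha' : a' ≤ a) : dropProfile m τ V a b ∈ dropProfiles V a' b := by
  refine ⟨memH10_dropProfile hm hab ha', fun x => ?_, integral_dropProfile hm hab⟩
  by_cases hx : x ∈ Ioo a b
  · exact (dropProfile_pos hm hτ hV hℓw hwV hx).le
  · exact (dropProfile_of_notMem hm hab hx).ge

theorem setOf_dropProfile_pos (hm : 0 < m) (hτ : 0 < τ) (hV : 0 < V) (hab : a < b)
    (hℓw : b - a ≤ w) (hwV : τ * cothGap (m * w / 2) ^ 2 = V * m ^ 2 / 2) :
    {x | 0 < dropProfile m τ V a b x} = Ioo a b := by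
  ext x
  refine ⟨fun hx => ?_, fun hx => dropProfile_pos hm hτ hV hℓw hwV hx⟩
  by_contra h
  exact absurd (dropProfile_of_notMem hm hab h) (ne_of_gt hx)

/-- First variation of the energy at the profile on `(a₁, b)`, in the direction of a competitor
on a possibly larger interval `(a, b)`. -/
theorem firstVariation_nonneg {a₁ : ℝ} (hm : 0 < m) (ha : a ≤ a₁) (hab : a₁ < b)
    (hend : a₁ = a ∨ (leftSlope m τ V (b - a₁) = 0 ∧
      V * m ^ 3 * Real.cosh (m * (b - a₁) / 2) / (2 * (cothGap (m * (b - a₁) / 2) *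
        Real.sinh (m * (b - a₁) / 2))) ≤ m ^ 2 * τ * ((b - a₁) / 2)))
    (hτ : 0 ≤ τ) {v : ℝ → ℝ} (hv : v ∈ dropProfiles V a b) :
    0 ≤ ∫ x, (deriv (dropProfile m τ V a₁ b) x * (deriv v x - deriv (dropProfile m τ V a₁ b) x) +
      m ^ 2 * dropProfile m τ V a₁ b x * (v x - dropProfile m τ V a₁ b x) -
      m ^ 2 * τ * x * (v x - dropProfile m τ V a₁ b x)) := by
  obtain ⟨hvH, hv0, hvV⟩ := hv
  set U := dropProfile m τ V a₁ b with hU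
  have hUH : MemH10 a b U := memH10_dropProfile hm hab ha
  set Λ := V * m ^ 3 * Real.cosh (m * (b - a₁) / 2) / (2 * (cothGap (m * (b - a₁) / 2) *
        Real.sinh (m * (b - a₁) / 2))) with hΛ
  set W := fun x => v x - U x with hW
  set ψ := fun x => dropShapeDeriv m τ V (b - a₁) (x - (a₁ + b) / 2) with hψ
  have hlt : a < b := ha.trans_lt hab
  have hvcont := hvH.continuous
  have hUcont := hUH.continuous
  have hWcont : Continuous W := hvcont.sub hUcont
  have hψ' : ∀ x ∈ Icc a₁ b, HasDerivAt ψ (m ^ 2 * U x - m ^ 2 * τ * (x - (a₁ + b) / 2) - Λ) x := by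
    intro x hx
    have := (hasDerivAt_dropShapeDeriv (m := m) (τ := τ) (V := V) (ℓ := b - a₁)
      (x - (a₁ + b) / 2)).comp_sub_const x ((a₁ + b) / 2)
    rwa [← dropProfile_of_mem hx] at this
  have hψac : AbsolutelyContinuousOnInterval ψ a₁ b := by
    apply ContDiffOn.absolutelyContinuousOnInterval
    have := (contDiff_dropShapeDeriv (m := m) (τ := τ) (V := V) 1 (b - a₁)).comp
      (contDiff_id.sub contDiff_const : ContDiff ℝ 1 fun x : ℝ => x - (a₁ + b) / 2)
    exact this.contDiffOn
  have hWab : AbsolutelyContinuousOnInterval W a b := hvH.absCont.fun_sub hUH.absCont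
  have hsub1 : uIcc a₁ b ⊆ uIcc a b := by
    rw [uIcc_of_le hab.le, uIcc_of_le hlt.le]; exact Icc_subset_Icc ha le_rfl
  have hWac : AbsolutelyContinuousOnInterval W a₁ b := hWab.mono hsub1
  have hWb : W b = 0 := by
    simp only [hW]; rw [hvH.eq_zero b (by simp), hUH.eq_zero b (by simp), sub_zero]
  -- The boundary term vanishes because either `a₁` is the common endpoint, where `W = 0`, or the
  -- profile has zero slope there.
  have hbd : ψ a₁ * W a₁ = 0 := by
    rcases hend with h | ⟨h, -⟩
    · simp only [hW]; rw [h, hvH.eq_zero a (by simp), hUH.eq_zero a (by simp)]; simp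
    · have : ψ a₁ = 0 := by
        simp only [hψ]
        rw [show a₁ - (a₁ + b) / 2 = -((b - a₁) / 2) by ring,
          dropShapeDeriv_left hm (sub_pos.2 hab), h]
      rw [this, zero_mul]
  set R := fun x => deriv U x * (deriv v x - deriv U x) + m ^ 2 * U x * (v x - U x) -
      m ^ 2 * τ * x * (v x - U x) with hR
  have hRint : Integrable R := by
    have i1 := (hUH.integrable_deriv_mul hvH).sub (hUH.integrable_deriv_mul hUH)
    have i2 : Integrable (fun x => m ^ 2 * U x * (v x - U x)) := by
      have := (hvH.integrable_mul (f := fun x => m ^ 2 * U x) (by fun_prop)).sub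
        (hUH.integrable_mul (f := fun x => m ^ 2 * U x) (by fun_prop))
      refine this.congr (ae_of_all _ fun x => ?_)
      simp only [Pi.sub_apply]; ring
    have i3 : Integrable (fun x => m ^ 2 * τ * x * (v x - U x)) := by
      have := (hvH.integrable_mul (f := fun x => m ^ 2 * τ * x) (by fun_prop)).sub
        (hUH.integrable_mul (f := fun x => m ^ 2 * τ * x) (by fun_prop))
      refine this.congr (ae_of_all _ fun x => ?_)
      simp only [Pi.sub_apply]; ring
    refine ((i1.add i2).sub i3).congr (ae_of_all _ fun x => ?_)
    simp only [Pi.sub_apply, Pi.add_apply, hR]; ring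
  have hRzero : ∀ x ∉ Icc a b, R x = 0 := by
    intro x hx
    have hx' : x ∉ Ioo a b := fun h => hx (Ioo_subset_Icc_self h)
    simp only [hR]
    rw [hUH.deriv_eq_zero hx, hvH.eq_zero x hx', hUH.eq_zero x hx']
    simp
  change 0 ≤ ∫ x, R x
  rw [integral_eq_intervalIntegral_of_eq_zero hlt.le hRzero,
    ← intervalIntegral.integral_add_adjacent_intervals (b := a₁)
      hRint.intervalIntegrable hRint.intervalIntegrable]
  have hUleft : ∀ x ≤ a₁, U x = 0 := fun x hx =>
    dropProfile_of_notMem hm hab (by simp [hx])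
  have hne : ∀ c : ℝ, ∀ᵐ x : ℝ, x ≠ c := fun c => by simp [ae_iff]
  have hleft : ∫ x in a..a₁, R x = ∫ x in a..a₁, -(m ^ 2 * τ * x) * v x := by
    refine intervalIntegral.integral_congr_ae ?_
    filter_upwards [hne a₁] with x hxne hx
    rw [uIoc_of_le ha] at hx
    have hxlt : x < a₁ := lt_of_le_of_ne hx.2 hxne
    have hd : deriv U x = 0 := by
      have : U =ᶠ[𝓝 x] fun _ => 0 := by
        filter_upwards [Iio_mem_nhds hxlt] with y hy using hUleft y (le_of_lt hy)
      rw [this.deriv_eq, deriv_const]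
    simp only [hR]
    rw [hd, hUleft x hx.2]
    ring
  have hWderiv : ∀ᵐ x, x ∈ uIoc a₁ b → deriv W x = deriv v x - deriv U x := by
    filter_upwards [hvH.absCont.ae_differentiableAt, hUH.absCont.ae_differentiableAt] with x h1 h2 hx
    have hx' := hsub1 (uIoc_subset_uIcc hx)
    exact ((h1 hx').hasDerivAt.sub (h2 hx').hasDerivAt).deriv
  -- Integration by parts and the Euler–Lagrange equation leave only a constant: the multiplier,
  -- corrected by the centre of the interval.
  have hright : ∫ x in a₁..b, R x = (m ^ 2 * τ * ((a₁ + b) / 2) - Λ) * (-∫ x in a₁..b, W x) := by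
    have e1 : ∫ x in a₁..b, R x =
        ∫ x in a₁..b, (ψ x * deriv W x + m ^ 2 * U x * W x - m ^ 2 * τ * x * W x) := by
      refine intervalIntegral.integral_congr_ae ?_
      filter_upwards [hne b, hWderiv] with x hxne hWx hx
      rw [hWx hx]
      rw [uIoc_of_le hab.le] at hx
      have := (hasDerivAt_dropProfile (m := m) (τ := τ) (V := V) (a := a₁) (b := b)
        ⟨hx.1, lt_of_le_of_ne hx.2 hxne⟩).deriv
      simp only [hR, hψ, hW]
      rw [hU, this]
    have e2 := AbsolutelyContinuousOnInterval.integral_mul_deriv_eq_deriv_mul hψac hWac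
    rw [hWb, mul_zero, hbd, sub_zero, zero_sub] at e2
    have e3 : ∫ x in a₁..b, deriv ψ x * W x =
        ∫ x in a₁..b, (m ^ 2 * U x * W x - m ^ 2 * τ * x * W x +
          (m ^ 2 * τ * ((a₁ + b) / 2) - Λ) * W x) := by
      refine intervalIntegral.integral_congr fun x hx => ?_
      rw [uIcc_of_le hab.le] at hx
      simp only [(hψ' x hx).deriv]
      ring
    have iψ : IntervalIntegrable (fun x => ψ x * deriv W x) volume a₁ b :=
      hWac.intervalIntegrable_deriv.continuousOn_mul hψac.continuousOn
    have i2 : IntervalIntegrable (fun x => m ^ 2 * U x * W x) volume a₁ b :=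
      Continuous.intervalIntegrable (by fun_prop) _ _
    have i3 : IntervalIntegrable (fun x => m ^ 2 * τ * x * W x) volume a₁ b :=
      Continuous.intervalIntegrable (by fun_prop) _ _
    have i4 : IntervalIntegrable (fun x => (m ^ 2 * τ * ((a₁ + b) / 2) - Λ) * W x) volume a₁ b :=
      Continuous.intervalIntegrable (by fun_prop) _ _
    rw [intervalIntegral.integral_add (i2.sub i3) i4, intervalIntegral.integral_sub i2 i3,
      intervalIntegral.integral_const_mul] at e3
    rw [e1, intervalIntegral.integral_sub (iψ.add i2) i3, intervalIntegral.integral_add iψ i2, e2,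
      e3]
    ring
  have hWtot : ∫ x in a..b, W x = 0 := by
    have hUV : ∫ x, U x = V := integral_dropProfile hm hab
    have h1 : ∫ x, W x = 0 := by
      simp only [hW]
      rw [integral_sub hvH.integrable hUH.integrable, hvV, hUV, sub_self]
    rw [← h1]
    refine (integral_eq_intervalIntegral_of_eq_zero hlt.le fun x hx => ?_).symm
    have hx' : x ∉ Ioo a b := fun h => hx (Ioo_subset_Icc_self h)
    simp only [hW]; rw [hvH.eq_zero x hx', hUH.eq_zero x hx', sub_zero]
  -- Equal volumes turn the constant into a weight on the mass of `v` to the left of `a₁`.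
  have hWsplit : -∫ x in a₁..b, W x = ∫ x in a..a₁, v x := by
    rw [← intervalIntegral.integral_add_adjacent_intervals (b := a₁)
      (hWcont.intervalIntegrable _ _) (hWcont.intervalIntegrable _ _)] at hWtot
    have : ∫ x in a..a₁, W x = ∫ x in a..a₁, v x := by
      refine intervalIntegral.integral_congr fun x hx => ?_
      rw [uIcc_of_le ha] at hx
      simp only [hW]; rw [hUleft x hx.2, sub_zero]
    linarith
  rw [hleft, hright, hWsplit, ← intervalIntegral.integral_const_mul,
    ← intervalIntegral.integral_add (Continuous.intervalIntegrable (by fun_prop) _ _)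
      (Continuous.intervalIntegrable (by fun_prop) _ _)]
  -- As `x ≤ a₁`, the coefficient of `v x` is at least `m ^ 2 * τ * ((b - a₁) / 2) - Λ`, whose sign
  -- is the second part of `hend`.
  refine intervalIntegral.integral_nonneg ha fun x hx => ?_
  rw [← add_mul]
  rcases hend with h | ⟨-, h⟩
  · have : x = a := le_antisymm (by linarith [hx.2]) hx.1
    rw [this, hvH.eq_zero a (by simp), mul_zero]
  · refine mul_nonneg ?_ (hv0 x)
    have : m ^ 2 * τ * x ≤ m ^ 2 * τ * a₁ := by
      have := hx.2; gcongr
    linarith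

/-- The energy is quadratic, so its expansion at the profile is exact: a nonnegative first variation
plus half the squared norms of the differences. Keeping the `L²` term gives minimality and
uniqueness together. -/
theorem dropEnergy_add_le {κ α a₁ : ℝ} (hm : 0 < m) (hτ : 0 ≤ τ)
    (hκc : κ * Real.cos α = m ^ 2) (hκs : κ * Real.sin α = m ^ 2 * τ) (ha : a ≤ a₁) (hab : a₁ < b)
    (hend : a₁ = a ∨ (leftSlope m τ V (b - a₁) = 0 ∧
      V * m ^ 3 * Real.cosh (m * (b - a₁) / 2) / (2 * (cothGap (m * (b - a₁) / 2) *
        Real.sinh (m * (b - a₁) / 2))) ≤ m ^ 2 * τ * ((b - a₁) / 2)))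
    {v : ℝ → ℝ} (hv : v ∈ dropProfiles V a b) :
    dropEnergy κ α (dropProfile m τ V a₁ b) +
      m ^ 2 / 2 * ∫ x, (v x - dropProfile m τ V a₁ b x) ^ 2 ≤ dropEnergy κ α v := by
  have hfirst := firstVariation_nonneg hm ha hab hend hτ hv
  obtain ⟨hvH, hv0, hvV⟩ := hv
  have hUH : MemH10 a b (dropProfile m τ V a₁ b) := memH10_dropProfile hm hab ha
  set U := dropProfile m τ V a₁ b with hU
  have hvc := hvH.continuous
  have hUc := hUH.continuous
  have hE : ∀ u : ℝ → ℝ, MemH10 a b u → Integrable (fun x => deriv u x ^ 2 / 2 +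
      u x ^ 2 / 2 * (κ * Real.cos α) - u x * x * (κ * Real.sin α)) := by
    intro u hu
    have hc := hu.continuous
    have i1 := (hu.integrable_deriv_mul hu).const_mul (1 / 2)
    have i2 := hu.integrable_mul (f := fun x => u x / 2 * (κ * Real.cos α)) (by fun_prop)
    have i3 := hu.integrable_mul (f := fun x => x * (κ * Real.sin α)) (by fun_prop)
    refine ((i1.add i2).sub i3).congr (ae_of_all _ fun x => ?_)
    simp only [Pi.sub_apply, Pi.add_apply]; ring
  have hS : Integrable (fun x => (v x - U x) ^ 2) := by
    have i1 := hvH.integrable_mul (f := fun x => v x - 2 * U x) (by fun_prop)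
    have i2 := hUH.integrable_mul hUc
    refine (i1.add i2).congr (ae_of_all _ fun x => ?_)
    simp only [Pi.add_apply]; ring
  have hD : Integrable (fun x => (deriv v x - deriv U x) ^ 2) := by
    have i1 := hvH.integrable_deriv_mul hvH
    have i2 := (hvH.integrable_deriv_mul hUH).const_mul 2
    have i3 := hUH.integrable_deriv_mul hUH
    refine ((i1.sub i2).add i3).congr (ae_of_all _ fun x => ?_)
    simp only [Pi.sub_apply, Pi.add_apply]; ring
  set R := fun x => deriv U x * (deriv v x - deriv U x) + m ^ 2 * U x * (v x - U x) -
      m ^ 2 * τ * x * (v x - U x) with hR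
  have hRint : Integrable R := by
    refine (((hE v hvH).sub (hE U hUH)).sub
      ((hD.const_mul (1 / 2)).add (hS.const_mul (m ^ 2 / 2)))).congr (ae_of_all _ fun x => ?_)
    simp only [Pi.sub_apply, Pi.add_apply, hR, hκc, hκs]
    ring
  have hsum : dropEnergy κ α v = dropEnergy κ α U + m ^ 2 / 2 * (∫ x, (v x - U x) ^ 2) +
      1 / 2 * (∫ x, (deriv v x - deriv U x) ^ 2) + ∫ x, R x := by
    have h1 : dropEnergy κ α v = ∫ x, (((deriv U x ^ 2 / 2 + U x ^ 2 / 2 * (κ * Real.cos α) -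
        U x * x * (κ * Real.sin α)) + m ^ 2 / 2 * (v x - U x) ^ 2) +
        1 / 2 * (deriv v x - deriv U x) ^ 2) + R x := by
      refine integral_congr_ae (ae_of_all _ fun x => ?_)
      simp only [hR, hκc, hκs]
      ring
    have i1 : Integrable (fun x => (deriv U x ^ 2 / 2 + U x ^ 2 / 2 * (κ * Real.cos α) -
        U x * x * (κ * Real.sin α)) + m ^ 2 / 2 * (v x - U x) ^ 2) :=
      (hE U hUH).add (hS.const_mul _)
    have i2 : Integrable (fun x => ((deriv U x ^ 2 / 2 + U x ^ 2 / 2 * (κ * Real.cos α) -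
        U x * x * (κ * Real.sin α)) + m ^ 2 / 2 * (v x - U x) ^ 2) +
        1 / 2 * (deriv v x - deriv U x) ^ 2) := i1.add (hD.const_mul _)
    rw [h1, integral_add i2 hRint, integral_add i1 (hD.const_mul _),
      integral_add (hE U hUH) (hS.const_mul _), integral_const_mul, integral_const_mul]
    rfl
  have hDnn : 0 ≤ ∫ x, (deriv v x - deriv U x) ^ 2 := integral_nonneg fun x => sq_nonneg _
  have hfirst' : 0 ≤ ∫ x, R x := hfirst
  linarith

variable {κ α : ℝ}

/-- On intervals of admissible width, the explicit profile is the energy minimizer. -/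
theorem isDropMinimizer_dropProfile (hm : 0 < m) (hτ : 0 < τ) (hV : 0 < V)
    (hκc : κ * Real.cos α = m ^ 2) (hκs : κ * Real.sin α = m ^ 2 * τ)
    (hwV : τ * cothGap (m * w / 2) ^ 2 = V * m ^ 2 / 2) (hab : b - a ∈ Ioc 0 w) :
    IsDropMinimizer κ α V a b (dropProfile m τ V a b) := by
  have hlt : a < b := sub_pos.1 hab.1
  refine ⟨dropProfile_mem_dropProfiles hm hτ hV hlt hab.2 hwV le_rfl, fun v hv => ?_⟩
  have h := dropEnergy_add_le hm hτ.le hκc hκs le_rfl hlt (Or.inl rfl) hv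
  have : 0 ≤ m ^ 2 / 2 * ∫ x, (v x - dropProfile m τ V a b x) ^ 2 :=
    mul_nonneg (by positivity) (integral_nonneg fun x => sq_nonneg _)
  exact (le_add_of_nonneg_right this).trans h

/-- Energy minimizers that are positive on the whole interval are the explicit profiles. -/
theorem IsDropMinimizer.eq_dropProfile (hm : 0 < m) (hτ : 0 < τ) (hV : 0 < V) (hw : 0 < w)
    (hκc : κ * Real.cos α = m ^ 2) (hκs : κ * Real.sin α = m ^ 2 * τ)
    (hwV : τ * cothGap (m * w / 2) ^ 2 = V * m ^ 2 / 2) {v : ℝ → ℝ}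
    (hv : IsDropMinimizer κ α V a b v) (hpos : {x | 0 < v x} = Ioo a b) :
    b - a ∈ Ioc 0 w ∧ v = dropProfile m τ V a b := by
  have hlt : a < b := by
    by_contra! h
    have h1 := hv.1.2.2
    rw [hv.1.1.eq_zero_of_le h] at h1
    simp only [Pi.zero_apply, integral_zero] at h1
    linarith
  -- Testing the minimizer `v` against the profile on `(a₁, b)` forces their `L²` distance to
  -- vanish.
  have key : ∀ a₁, a ≤ a₁ → a₁ < b → b - a₁ ≤ w → (a₁ = a ∨ b - a₁ = w) →
      v = dropProfile m τ V a₁ b := by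
    intro a₁ ha hab hle hend
    have hUmem := dropProfile_mem_dropProfiles hm hτ hV hab hle hwV ha
    have h1 := dropEnergy_add_le (κ := κ) (α := α) hm hτ.le hκc hκs ha hab (by
      refine hend.imp id fun h => ?_
      rw [h]
      exact ⟨leftSlope_eq_zero hm hw hwV, mul_coth_le_of_maximal_width hm hτ hw hwV⟩) hv.1
    have h2 : dropEnergy κ α v ≤ dropEnergy κ α (dropProfile m τ V a₁ b) := hv.2 hUmem
    have hvc := hv.1.1.continuous
    have hUc := hUmem.1.continuous
    have h3 : ∫ x, (v x - dropProfile m τ V a₁ b x) ^ 2 = 0 := by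
      refine le_antisymm ?_ (integral_nonneg fun x => sq_nonneg _)
      have : 0 < m ^ 2 / 2 := by positivity
      by_contra! hc
      have := mul_pos this hc
      linarith
    have hcs : HasCompactSupport (fun x => (v x - dropProfile m τ V a₁ b x) ^ 2) := by
      refine HasCompactSupport.intro (isCompact_Icc (a := a) (b := b)) fun x hx => ?_
      have hx' : x ∉ Ioo a b := fun h => hx (Ioo_subset_Icc_self h)
      rw [hv.1.1.eq_zero x hx', hUmem.1.eq_zero x hx']
      simp
    have hcont : Continuous (fun x => (v x - dropProfile m τ V a₁ b x) ^ 2) := by fun_prop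
    rw [integral_eq_zero_iff_of_nonneg (fun x => sq_nonneg _)
      (hcont.integrable_of_hasCompactSupport hcs)] at h3
    have h4 := Continuous.ae_eq_iff_eq volume hcont continuous_zero |>.1 h3
    funext x
    have := congrFun h4 x
    simp only [Pi.zero_apply] at this
    exact sub_eq_zero.1 (pow_eq_zero_iff two_ne_zero |>.1 this)
  rcases le_or_gt (b - a) w with hle | hgt
  · exact ⟨⟨sub_pos.2 hlt, hle⟩, key a le_rfl hlt hle (Or.inl rfl)⟩
  · exfalso
    -- On an interval longer than `w` the minimizer would be the profile on `(b - w, b)`, which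
    -- vanishes at the midpoint of `(a, b - w)`, against positivity.
    have h := key (b - w) (by linarith) (by linarith) (by linarith) (Or.inr (by ring))
    have hx : (a + (b - w)) / 2 ∈ Ioo a b := by constructor <;> linarith
    rw [← hpos] at hx
    have hx' : 0 < v ((a + (b - w)) / 2) := hx
    rw [h, dropProfile_of_notMem hm (by linarith) (by simp; intros; linarith)] at hx'
    exact lt_irrefl _ hx'

end Profile

/-! ### Drop evolutions as evolutions of the contact points -/

section Evolution

variable {κ α m τ V w : ℝ} {c : ℝ → ℝ → ℝ} {u₀ : ℝ → ℝ} {u : ℝ → ℝ → ℝ}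

/-- In the condition `min = 0` a nonzero slope forces the velocity law. The right slope never
vanishes, and the left one vanishes only at the maximal width. -/
theorem IsDropSolution.exists_contactEvolution (hm : 0 < m) (hτ : 0 < τ) (hV : 0 < V) (hw : 0 < w)
    (hκc : κ * Real.cos α = m ^ 2) (hκs : κ * Real.sin α = m ^ 2 * τ)
    (hwV : τ * cothGap (m * w / 2) ^ 2 = V * m ^ 2 / 2) (hu : IsDropSolution κ α V c u₀ u) :
    ∃ a b : ℝ → ℝ, {x | 0 < u₀ x} = Ioo (a 0) (b 0) ∧
      IsContactEvolution (fun ℓ => leftSlope m τ V ℓ ^ 2 / 2)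
        (fun ℓ => rightSlope m τ V ℓ ^ 2 / 2) w c a b ∧
      ∀ t, 0 ≤ t → (fun x => u x t) = dropProfile m τ V (a t) (b t) := by
  obtain ⟨a, b, hLa, hLb, h0, hsupp, hmin, hA, hB⟩ := hu
  have hprof := fun t (ht : 0 ≤ t) =>
    (hmin t ht).eq_dropProfile hm hτ hV hw hκc hκs hwV (hsupp t ht)
  rw [ae_restrict_iff' measurableSet_Ici] at hA hB
  refine ⟨a, b, h0, ⟨hLa, hLb, fun t ht => (hprof t ht).1, ?_, ?_⟩, fun t ht => (hprof t ht).2⟩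
  · filter_upwards [hA] with t hAt ht
    obtain ⟨d, p, hd, hp, hlaw⟩ := hAt ht
    obtain ⟨hwid, heq⟩ := hprof t ht
    have hlt : a t < b t := sub_pos.1 hwid.1
    rw [heq] at hp
    have hpeq : p = leftSlope m τ V (b t - a t) :=
      (uniqueDiffOn_Ici (a t) (a t) self_mem_Ici).eq_deriv _ hp
        (hasDerivWithinAt_dropProfile_left hm hlt)
    subst hpeq
    refine ⟨d, hd, ?_, fun hltw => ?_⟩
    · have := hlaw.ge.trans (min_le_left _ _)
      linarith
    · have hpos := abs_pos.2 (leftSlope_pos hm hτ hV hwid.1 hltw hwV).ne'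
      rcases min_choice (d + c (leftSlope m τ V (b t - a t) ^ 2 / 2) (a t))
        |leftSlope m τ V (b t - a t)| with h | h
      · rw [h] at hlaw; linarith
      · rw [h] at hlaw; exact absurd hlaw hpos.ne'
  · filter_upwards [hB] with t hBt ht
    obtain ⟨d, p, hd, hp, hlaw⟩ := hBt ht
    obtain ⟨hwid, heq⟩ := hprof t ht
    have hlt : a t < b t := sub_pos.1 hwid.1
    rw [heq] at hp
    have hpeq : p = rightSlope m τ V (b t - a t) :=
      (uniqueDiffOn_Iic (b t) (b t) self_mem_Iic).eq_deriv _ hp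
        (hasDerivWithinAt_dropProfile_right hm hlt)
    subst hpeq
    have hpos := abs_pos.2 (rightSlope_neg (V := V) hm hτ hV hwid.1).ne
    have : d = c (rightSlope m τ V (b t - a t) ^ 2 / 2) (b t) := by
      rcases min_choice (-d + c (rightSlope m τ V (b t - a t) ^ 2 / 2) (b t))
        |rightSlope m τ V (b t - a t)| with h | h
      · rw [h] at hlaw; linarith
      · rw [h] at hlaw; exact absurd hlaw hpos.ne'
    exact this ▸ hd

theorem IsContactEvolution.isDropSolution (hm : 0 < m) (hτ : 0 < τ) (hV : 0 < V) (hw : 0 < w)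
    (hκc : κ * Real.cos α = m ^ 2) (hκs : κ * Real.sin α = m ^ 2 * τ)
    (hwV : τ * cothGap (m * w / 2) ^ 2 = V * m ^ 2 / 2) {a b : ℝ → ℝ}
    (h : IsContactEvolution (fun ℓ => leftSlope m τ V ℓ ^ 2 / 2)
        (fun ℓ => rightSlope m τ V ℓ ^ 2 / 2) w c a b)
    (h0 : {x | 0 < u₀ x} = Ioo (a 0) (b 0)) :
    IsDropSolution κ α V c u₀ (fun x t => dropProfile m τ V (a t) (b t) x) := by
  refine ⟨a, b, h.lipschitzA, h.lipschitzB, h0, fun t ht => ?_, fun t ht => ?_, ?_, ?_⟩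
  · exact setOf_dropProfile_pos hm hτ hV (sub_pos.1 (h.width_mem t ht).1) (h.width_mem t ht).2 hwV
  · exact isDropMinimizer_dropProfile hm hτ hV hκc hκs hwV (h.width_mem t ht)
  · rw [ae_restrict_iff' measurableSet_Ici]
    filter_upwards [h.lawA] with t hA ht
    obtain ⟨d, hd, hle, heq⟩ := hA ht
    have hwid := h.width_mem t ht
    refine ⟨d, _, hd, hasDerivWithinAt_dropProfile_left hm (sub_pos.1 hwid.1), ?_⟩
    rcases hwid.2.lt_or_eq with hlt | hmax
    · rw [heq hlt, neg_add_cancel]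
      exact min_eq_left (abs_nonneg _)
    · have hz : leftSlope m τ V (b t - a t) = 0 := by
        rw [hmax]; exact leftSlope_eq_zero hm hw hwV
      rw [hz] at hle ⊢
      rw [abs_zero]
      exact min_eq_right (by linarith)
  · rw [ae_restrict_iff' measurableSet_Ici]
    filter_upwards [h.lawB] with t hB ht
    have hwid := h.width_mem t ht
    refine ⟨_, _, hB ht, hasDerivWithinAt_dropProfile_right hm (sub_pos.1 hwid.1), ?_⟩
    rw [neg_add_cancel]
    exact min_eq_left (abs_nonneg _)

/-- Clamping reduces all positions `x` to a compact set of arguments of `dropShape`, and `μ > 0`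
keeps the widths away from the singularity at `0`. -/
theorem tendstoUniformlyOn_dropProfile {ι : Type*} {l : Filter ι} {S : Set ℝ} {a b : ℝ → ℝ}
    {aε bε : ι → ℝ → ℝ} {μ : ℝ} (hm : 0 < m) (hμ : 0 < μ)
    (ha : TendstoUniformlyOn aε a l S) (hb : TendstoUniformlyOn bε b l S)
    (hε : ∀ᶠ ε in l, ∀ t ∈ S, bε ε t - aε ε t ∈ Icc μ w) (h : ∀ t ∈ S, b t - a t ∈ Icc μ w) :
    TendstoUniformlyOn (fun ε (p : ℝ × ℝ) => dropProfile m τ V (aε ε p.2) (bε ε p.2) p.1)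
      (fun p => dropProfile m τ V (a p.2) (b p.2) p.1) l (univ ×ˢ S) := by
  have hK : IsCompact (Icc μ w ×ˢ Icc (-(w / 2)) (w / 2)) := isCompact_Icc.prod isCompact_Icc
  have huc := hK.uniformContinuousOn_of_continuous
    ((continuousOn_dropShape (m := m) (τ := τ) (V := V) hm).mono
      (prod_mono (fun x hx => hμ.trans_le hx.1) (subset_univ _)))
  rw [Metric.uniformContinuousOn_iff] at huc
  rw [Metric.tendstoUniformlyOn_iff] at *
  intro η hη
  obtain ⟨δ, hδ, hδη⟩ := huc η hη
  have hclamp : ∀ ℓ ∈ Icc μ w, ∀ y, max (-(ℓ / 2)) (min (ℓ / 2) y) ∈ Icc (-(w / 2)) (w / 2) := by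
    intro ℓ hℓ y
    have h1 := clamp_mem (p := ℓ / 2) (by linarith [hℓ.1]) y
    exact ⟨by linarith [h1.1, hℓ.2], by linarith [h1.2, hℓ.2]⟩
  filter_upwards [ha (δ / 2) (by positivity), hb (δ / 2) (by positivity), hε] with ε h1 h2 h3
  rintro ⟨x, t⟩ ⟨-, ht⟩
  have h1 := h1 t ht
  have h2 := h2 t ht
  refine hδη (_, _) ⟨h t ht, hclamp _ (h t ht) _⟩ (_, _) ⟨h3 t ht, hclamp _ (h3 t ht) _⟩ ?_
  rw [Real.dist_eq, abs_lt] at h1 h2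
  rw [Prod.dist_eq, max_lt_iff]
  dsimp only
  constructor
  · rw [Real.dist_eq, abs_lt]
    constructor <;> linarith
  · refine (abs_clamp_sub_clamp_le _ _ _ _).trans_lt (max_lt ?_ ?_)
    all_goals
      rw [abs_lt]
      constructor <;> linarith

end Evolution

theorem Ioo_endpoints_eq {a b a' b' : ℝ} (hab : a < b) (hab' : a' < b')
    (h : Ioo a b = Ioo a' b') : a = a' ∧ b = b' := by
  constructor
  · rw [← csInf_Ioo hab, h, csInf_Ioo hab']
  · rw [← csSup_Ioo hab, h, csSup_Ioo hab']

end

/-! ### Homogenization of drop evolutions. -/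

theorem theorem2p7 (κ α V₀ : ℝ) (hκ : 0 < κ) (hα : 0 < α) (hα' : α < Real.pi / 2) (hV : 0 < V₀)
    (β : ℝ → ℝ) (hβ : ∃ K, LipschitzWith K β) (L : ℝ) (hL : 0 < L) (hper : Function.Periodic β L)
    (u₀ : ℝ → ℝ) (hu₀ : IsInitialDrop κ α V₀ u₀) :
    ∃ r : ℝ → ℝ, (∀ q, IsEffectiveSpeed β q (r q)) ∧
      (∀ uε : ℝ → ℝ → ℝ → ℝ,
        (∀ ε, 0 < ε → IsDropSolution κ α V₀ (fun q x => q - β (x / ε)) u₀ (uε ε)) →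
        ∃ u : ℝ → ℝ → ℝ, IsDropSolution κ α V₀ (fun q _ => r q) u₀ u ∧
          ∀ T : ℝ, TendstoUniformlyOn (fun (ε : ℝ) (p : ℝ × ℝ) => uε ε p.1 p.2)
            (fun p => u p.1 p.2) (𝓝[>] 0) (univ ×ˢ Icc 0 T)) ∧
      (∀ u v : ℝ → ℝ → ℝ, IsDropSolution κ α V₀ (fun q _ => r q) u₀ u →
        IsDropSolution κ α V₀ (fun q _ => r q) u₀ v → ∀ t, 0 ≤ t → ∀ x, u x t = v x t) := by
  obtain ⟨K, hK⟩ := hβ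
  obtain ⟨B, hB⟩ : ∃ B, ∀ x, |β x| ≤ B := by
    obtain ⟨B, hB⟩ := (hper.isBounded_of_continuous hL.ne' hK.continuous).exists_norm_le
    exact ⟨B, fun x => hB _ (mem_range_self x)⟩
  obtain ⟨r, hr⟩ := exists_hasSpeed hK hB hL hper
  have hrc : Continuous r := hr.continuous (by fun_prop) hK hB
  have hrm : Monotone r := hr.monotone hK hB
  have hcos : 0 < Real.cos α := Real.cos_pos_of_mem_Ioo ⟨by linarith [Real.pi_pos], hα'⟩
  have hτ : 0 < Real.tan α := Real.tan_pos_of_pos_of_lt_pi_div_two hα hα'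
  set m := Real.sqrt (κ * Real.cos α) with hmdef
  set τ := Real.tan α with hτdef
  have hm : 0 < m := Real.sqrt_pos.2 (by positivity)
  have hκc : κ * Real.cos α = m ^ 2 := (Real.sq_sqrt (by positivity)).symm
  have hκs : κ * Real.sin α = m ^ 2 * τ := by
    rw [← hκc, hτdef, Real.tan_eq_sin_div_cos]
    field_simp
  obtain ⟨w, hw, hwV⟩ := exists_maximal_width hm hτ hV
  have hQ := isSlopeLaw hm hτ hV hw hwV
  refine ⟨r, fun q => hr.isEffectiveSpeed hK hB q, fun uε huε => ?_, fun u v hu hv t ht x => ?_⟩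
  · have hex := fun ε (hε : 0 < ε) =>
      (huε ε hε).exists_contactEvolution hm hτ hV hw hκc hκs hwV
    choose! aε bε hinit hev hprof using hex
    -- All evolutions start from the support of `u₀`, so the endpoints for `ε = 1` serve as the
    -- common initial data.
    have hends : ∀ ε, 0 < ε → aε ε 0 = aε 1 0 ∧ bε ε 0 = bε 1 0 := fun ε hε =>
      Ioo_endpoints_eq (sub_pos.1 ((hev ε hε).width_mem 0 le_rfl).1)
        (sub_pos.1 ((hev 1 one_pos).width_mem 0 le_rfl).1)
        ((hinit ε hε).symm.trans (hinit 1 one_pos))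
    obtain ⟨a, b, hab, ha0, hb0, ⟨μ, hμ, hμw⟩, hconv⟩ := exists_tendsto_contactEvolution hQ
      (fun ℓ _ => by positivity) hr hrc hrm hK hB hev (fun ε hε => (hends ε hε).1)
      (fun ε hε => (hends ε hε).2)
    refine ⟨_, hab.isDropSolution hm hτ hV hw hκc hκs hwV
      (by rw [ha0, hb0]; exact hinit 1 one_pos), fun T => ?_⟩
    obtain ⟨hca, hcb⟩ := hconv T
    have hpos : ∀ᶠ ε in 𝓝[>] (0 : ℝ), 0 < ε := self_mem_nhdsWithin
    have hlow : ∀ t ∈ Icc 0 T, b t - a t ∈ Icc μ w := fun t ht =>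
      ⟨ge_of_tendsto ((hcb.tendsto_at ht).sub (hca.tendsto_at ht))
        (hpos.mono fun ε hε => hμw ε hε t ht.1), (hab.width_mem t ht.1).2⟩
    refine (tendstoUniformlyOn_dropProfile hm hμ hca hcb
      (hpos.mono fun ε hε t ht => ⟨hμw ε hε t ht.1, ((hev ε hε).width_mem t ht.1).2⟩)
      hlow).congr ?_
    filter_upwards [hpos] with ε hε
    rintro ⟨x, t⟩ ⟨-, ht⟩
    exact (congrFun (hprof ε hε t ht.1) x).symm
  · obtain ⟨a₁, b₁, h0₁, hev₁, hu⟩ := hu.exists_contactEvolution hm hτ hV hw hκc hκs hwV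
    obtain ⟨a₂, b₂, h0₂, hev₂, hv⟩ := hv.exists_contactEvolution hm hτ hV hw hκc hκs hwV
    obtain ⟨ea, eb⟩ := Ioo_endpoints_eq (sub_pos.1 (hev₁.width_mem 0 le_rfl).1)
      (sub_pos.1 (hev₂.width_mem 0 le_rfl).1) (h0₁.symm.trans h0₂)
    obtain ⟨ea, eb⟩ := hev₁.eq hQ hrm hev₂ ea eb ht
    have h1 := congrFun (hu t ht) x
    have h2 := congrFun (hv t ht) x
    rw [h1, h2, ea, eb]
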